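/- Let $D\subset\mathbb R^2$ be open and let $f:D\to\mathbb R^3$ be a ($C^\infty$) front with Gauss map $\nu:D\to S^2$, that is, $\langle df_q(X),\nu(q)\rangle=0$ for all $q\in D$, $X\in\mathbb R^2$, and $(f,\nu)$ is an immersion. Let $S(f)=\{q\in D:\operatorname{rank}df_q<2\}$, and let $p\in D$ be a cuspidal edge of $f$, i.e. $f$ at $p$ is $\mathcal A$-equivalent (equivalent under $C^\infty$ diffeomorphism germs of source and target) to $(u,v)\mapsto(u,v^2,v^3)$ at $0$. Let $\lambda=\det(f_u,f_v,\nu)$ and $\Lambda=\det(\nu_u,\nu_v,\nu)$ in the standard coordinates of the plane. Let $U\subset D$ be an open neighbourhood of $p$ and $\gamma:(-\varepsilon,\varepsilon)\to U$ a regular $C^\infty$ curve with $\gamma(0)=p$ and image $S(f)\cap U$ (the singular curve), oriented so that $\lambda>0$ on its left-hand side. Suppose that the Gaussian curvature $K$ of $f$ is non-zero and bounded on $U\setminus S(f)$, and that $\nu$ has a cusp at $p$, i.e. $\nu$ at $p$ is $\mathcal A$-equivalent to $(u,v)\mapsto(u,v^3+uv)$ at $0$. An adapted coordinate system is an orientation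 preserving $C^\infty$ local coordinate system $(u,v)$ of $D$ centred at $p$ in which the singular points of $f$ are exactly the points with $v=0$ and $f_v(u,0)=0$. Along the $u$-axis put $$\kappa_s=\operatorname{sgn}\bigl(\partial_v\det(f_u,f_v,\nu)\bigr)\frac{\det(f_u,f_{uu},\nu)}{|f_u|^3},\qquad \kappa_t=\frac{\det(f_u,f_{vv},f_{uvv})}{|f_u\times f_{vv}|^2}-\frac{\langle f_u,f_{vv}\rangle\det(f_u,f_{vv},f_{uu})}{|f_u|^2|f_u\times f_{vv}|^2},$$ and let $\kappa_t'=|f_u|^{-1}\,d\kappa_t/du$ be the derivative of $\kappa_t$ with respect to the arc length of $u\mapsto f(u,0)$. For a spherical curve $c$ with an ordinary cusp at $t_0$ (that is, $c$ at $t_0$ is $\mathcal A$-equivalent to $t\mapsto(t^2,t^3)$ at $0$) the cuspidal curvature is $$\mu=\frac{\det(c,D_t\dot c,D_tD_t\dot c)}{|D_t\dot c|^{5/2}}\Big|_{t=t_0},$$ where $D$ is the covariant derivative of $S^2$; the cusp is called positive (resp. negative) if $\mu>0$ (resp. $\mu<0$). Then, near $p$, $\gamma$ is also a parabolic curve, i.e.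 for some $0<\delta\le\varepsilon$ and some open neighbourhood $V\subset U$ of $p$ it maps $(-\delta,\delta)$ onto $\{q\in V:\Lambda(q)=0\}$; taking $\sigma=\gamma$, the singular locus $\nu\circ\sigma$ of $\nu$ has an ordinary cusp at $0$. Adapted coordinate systems at $p$ exist, and in each of them: $p$ is a positive (resp. negative) cusp of $\nu\circ\sigma$ if and only if $\kappa_s(p)>0$ (resp. $\kappa_s(p)<0$); moreover $\kappa_t'(p)\ne0$ and the cuspidal curvature $\mu^\nu$ of $\nu\circ\sigma$ at $p$ is $$\mu^\nu=\frac{2\kappa_s(p)}{\sqrt{|\kappa_t'(p)|}} .$$ -/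

import Mathlib

open Set Filter Topology
open scoped Manifold ContDiff RealInnerProductSpace

noncomputable section

namespace FrontSurface

/-- Euclidean 3-space. -/
abbrev E3 : Type := EuclideanSpace ℝ (Fin 3)

/-- The unit sphere of Euclidean 3-space. -/
abbrev S2 : Type := Metric.sphere (0 : E3) 1

/-- `det(a, b, c)`. -/
def det3 (a b c : E3) : ℝ :=
  Matrix.det !![a 0, a 1, a 2; b 0, b 1, b 2; c 0, c 1, c 2]

/-- The vector product in Euclidean 3-space. -/
def cross (a b : E3) : E3 := WithLp.toLp 2 (crossProduct a.ofLp b.ofLp)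

/-- Partial derivative in the first variable. -/
def pu {F : Type*} [NormedAddCommGroup F] [NormedSpace ℝ F] (g : ℝ × ℝ → F) (q : ℝ × ℝ) : F :=
  deriv (fun s : ℝ => g (s, q.2)) q.1

/-- Partial derivative in the second variable. -/
def pv {F : Type*} [NormedAddCommGroup F] [NormedSpace ℝ F] (g : ℝ × ℝ → F) (q : ℝ × ℝ) : F :=
  deriv (fun s : ℝ => g (q.1, s)) q.2

/-- `f` is a front on the open set `D` of the plane, with Gauss map `ν`. -/
structure IsFront (f : ℝ × ℝ → E3) (ν : ℝ × ℝ → S2) (D : Set (ℝ × ℝ)) : Prop where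
  smooth : ContDiffOn ℝ ∞ f D
  smooth_gauss : ContDiffOn ℝ ∞ (fun q => (ν q : E3)) D
  orthogonal : ∀ q ∈ D, ∀ X : ℝ × ℝ, ⟪fderiv ℝ f q X, (ν q : E3)⟫ = 0
  immersive : ∀ q ∈ D,
    Function.Injective (fderiv ℝ (fun x => (f x, (ν x : E3))) q)

/-- The singular set `S(f)`: the points where the rank of the differential is less than 2. -/
def singularSet (f : ℝ × ℝ → E3) (D : Set (ℝ × ℝ)) : Set (ℝ × ℝ) :=
  {q ∈ D | Module.finrank ℝ (LinearMap.range (fderiv ℝ f q).toLinearMap) < 2}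

/-- The germ of `f` at `p` is `𝒜`-equivalent to the germ of `g` at `0`
(diffeomorphism germs `φ` of the source and `Φ` of the target with `Φ ∘ f = g ∘ φ`). -/
def AEquivalentAt {E F N : Type*} [NormedAddCommGroup E] [NormedSpace ℝ E]
    [NormedAddCommGroup F] [NormedSpace ℝ F] [TopologicalSpace N] [ChartedSpace F N]
    (f : E → N) (p : E) (g : E → F) : Prop :=
  ∃ (φ : PartialDiffeomorph 𝓘(ℝ, E) 𝓘(ℝ, E) E E ∞)
    (Φ : PartialDiffeomorph 𝓘(ℝ, F) 𝓘(ℝ, F) N F ∞),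
    p ∈ φ.source ∧ φ p = 0 ∧ f p ∈ Φ.source ∧ Φ (f p) = 0 ∧
    ∀ᶠ x in 𝓝 p, f x ∈ Φ.source ∧ Φ (f x) = g (φ x)

/-- `f` has a cuspidal edge at `p`: it is `𝒜`-equivalent to `(u, v) ↦ (u, v², v³)`. -/
def IsCuspidalEdge (f : ℝ × ℝ → E3) (p : ℝ × ℝ) : Prop :=
  AEquivalentAt f p (fun q : ℝ × ℝ => (!₂[q.1, q.2 ^ 2, q.2 ^ 3] : E3))

/-- The map `ν` into the sphere has a cusp at `p`:
it is `𝒜`-equivalent to `(u, v) ↦ (u, v³ + uv)`. -/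
def IsCuspOfMap (ν : ℝ × ℝ → S2) (p : ℝ × ℝ) : Prop :=
  AEquivalentAt ν p
    (fun q : ℝ × ℝ => (!₂[q.1, q.2 ^ 3 + q.1 * q.2] : EuclideanSpace ℝ (Fin 2)))

/-- The signed area density function `λ = det(f_u, f_v, ν)`. -/
def signedAreaDensity (f : ℝ × ℝ → E3) (ν : ℝ × ℝ → S2) (q : ℝ × ℝ) : ℝ :=
  det3 (pu f q) (pv f q) (ν q)

/-- The discriminant function `Λ = det(ν_u, ν_v, ν)` of the Gauss map. -/
def discriminant (ν : ℝ × ℝ → S2) (q : ℝ × ℝ) : ℝ :=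
  det3 (pu (fun x => (ν x : E3)) q) (pv (fun x => (ν x : E3)) q) (ν q)

/-- The Gaussian curvature `(LN - M²) / (EG - F²)` (meaningful at regular points). -/
def gaussianCurvature (f : ℝ × ℝ → E3) (ν : ℝ × ℝ → S2) (q : ℝ × ℝ) : ℝ :=
  let n : ℝ × ℝ → E3 := fun x => (ν x : E3)
  let E := ⟪pu f q, pu f q⟫
  let F := ⟪pu f q, pv f q⟫
  let G := ⟪pv f q, pv f q⟫
  let L := -⟪pu f q, pu n q⟫
  let M := -⟪pu f q, pv n q⟫
  let N := -⟪pv f q, pv n q⟫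
  (L * N - M ^ 2) / (E * G - F ^ 2)

/-- `c : (-ε, ε) → ℝ²` is a smooth regular curve with `c 0 = p`. -/
structure IsRegularCurveThrough (c : ℝ → ℝ × ℝ) (p : ℝ × ℝ) (ε : ℝ) : Prop where
  smooth : ContDiffOn ℝ ∞ c (Ioo (-ε) ε)
  regular : ∀ t ∈ Ioo (-ε) ε, deriv c t ≠ 0
  zero : c 0 = p

/-- The left-hand side of the regular curve `γ : (-ε, ε) → ℝ²` is the region `λ > 0`: the values
of `l` are positive on the left normal of `γ`, near every point of `γ`. -/
def PositiveOnLeft (γ : ℝ → ℝ × ℝ) (ε : ℝ) (l : ℝ × ℝ → ℝ) : Prop :=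
  ∀ t ∈ Ioo (-ε) ε, ∀ᶠ s in 𝓝[>] (0 : ℝ),
    0 < l (γ t + s • (-(deriv γ t).2, (deriv γ t).1))

/-- An adapted coordinate system `(u, v)` centred at `p`, given as the parametrization
`(u, v) ↦ X (u, v)` of an open subset of `D`: it preserves the orientation, its singular points
are exactly those of the `u`-axis, and `∂_v` is a null vector field there. -/
structure IsAdapted (X : PartialDiffeomorph 𝓘(ℝ, ℝ × ℝ) 𝓘(ℝ, ℝ × ℝ) (ℝ × ℝ) (ℝ × ℝ) ∞)
    (f : ℝ × ℝ → E3) (D : Set (ℝ × ℝ)) (p : ℝ × ℝ) : Prop where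
  zero_mem : (0 : ℝ × ℝ) ∈ X.source
  map_zero : X 0 = p
  subset : X.target ⊆ D
  orientation : ∀ q ∈ X.source, 0 < (fderiv ℝ X q).det
  singular_iff : ∀ q ∈ X.source, X q ∈ singularSet f D ↔ q.2 = 0
  null : ∀ u : ℝ, (u, (0 : ℝ)) ∈ X.source → pv (fun q => f (X q)) (u, 0) = 0

/-- The singular curvature at `(u, 0)`, for a front `g` with Gauss map `n`
written in adapted coordinates. -/
def singularCurvature (g : ℝ × ℝ → E3) (n : ℝ × ℝ → S2) (u : ℝ) : ℝ :=
  (SignType.sign (pv (signedAreaDensity g n) (u, 0)) : ℝ) *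
    (det3 (pu g (u, 0)) (pu (pu g) (u, 0)) (n (u, 0)) / ‖pu g (u, 0)‖ ^ 3)

/-- The cuspidal torsion at `(u, 0)`, for a front `g` written in adapted coordinates. -/
def cuspidalTorsion (g : ℝ × ℝ → E3) (u : ℝ) : ℝ :=
  let gu := pu g (u, 0)
  let guu := pu (pu g) (u, 0)
  let gvv := pv (pv g) (u, 0)
  let guvv := pu (pv (pv g)) (u, 0)
  det3 gu gvv guvv / ‖cross gu gvv‖ ^ 2
    - ⟪gu, gvv⟫ * det3 gu gvv guu / (‖gu‖ ^ 2 * ‖cross gu gvv‖ ^ 2)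

/-- The derivative at `(0, 0)` of the cuspidal torsion with respect to the arc length of the
image of the `u`-axis (in special adapted coordinates, where `|g_u| = 1` on the `u`-axis,
this is `dκ_t/du`). -/
def cuspidalTorsionDeriv (g : ℝ × ℝ → E3) : ℝ :=
  deriv (cuspidalTorsion g) 0 / ‖pu g (0, 0)‖

/-- Covariant derivative in the sphere of a vector field `V` along the spherical curve `c`. -/
def covDeriv (c : ℝ → S2) (V : ℝ → E3) (t : ℝ) : E3 :=
  deriv V t - ⟪deriv V t, (c t : E3)⟫ • (c t : E3)

/-- The velocity of a spherical curve. -/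
def velocity (c : ℝ → S2) (t : ℝ) : E3 := deriv (fun s => (c s : E3)) t

/-- The cuspidal curvature of a spherical curve at an ordinary cusp. -/
def cuspidalCurvature (c : ℝ → S2) (t : ℝ) : ℝ :=
  det3 (c t) (covDeriv c (velocity c) t) (covDeriv c (covDeriv c (velocity c)) t) /
    ‖covDeriv c (velocity c) t‖ ^ (5 / 2 : ℝ)

/-- The spherical curve `c` has an ordinary cusp at `t`:
it is `𝒜`-equivalent to `t ↦ (t², t³)`. -/
def IsOrdinaryCusp (c : ℝ → S2) (t : ℝ) : Prop :=
  AEquivalentAt c t (fun s : ℝ => (!₂[s ^ 2, s ^ 3] : EuclideanSpace ℝ (Fin 2)))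

/-- A positive cusp (zig) of a spherical curve. -/
def IsPositiveCusp (c : ℝ → S2) (t : ℝ) : Prop :=
  IsOrdinaryCusp c t ∧ 0 < cuspidalCurvature c t

/-- A negative cusp (zag) of a spherical curve. -/
def IsNegativeCusp (c : ℝ → S2) (t : ℝ) : Prop :=
  IsOrdinaryCusp c t ∧ cuspidalCurvature c t < 0

/-- `γ : (-ε, ε) → U` is a singular curve of `f` through `p`: a smooth regular curve that
parametrizes the singular points of `f` in `U`. -/
structure IsSingularCurve (γ : ℝ → ℝ × ℝ) (ε : ℝ) (f : ℝ × ℝ → E3) (D U : Set (ℝ × ℝ))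
    (p : ℝ × ℝ) : Prop extends IsRegularCurveThrough γ p ε where
  image_eq : γ '' Ioo (-ε) ε = singularSet f D ∩ U

/-- `σ : (-δ, δ) → V` is a parabolic curve through `p`: a smooth regular curve that
parametrizes the singular points of the Gauss map in `V`. -/
structure IsParabolicCurve (σ : ℝ → ℝ × ℝ) (δ : ℝ) (ν : ℝ × ℝ → S2) (V : Set (ℝ × ℝ))
    (p : ℝ × ℝ) : Prop extends IsRegularCurveThrough σ p δ where
  image_eq : σ '' Ioo (-δ) δ = {q ∈ V | discriminant ν q = 0}

end FrontSurface

end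

open FrontSurface

/-!
# The Gauss map of a front along a cuspidal edge

Write `λ = det(f_u, f_v, ν)` and `Λ = det(ν_u, ν_v, ν)`. The Weingarten relation gives `Λ = K λ` at
regular points (`IsFront.gaussianCurvature_eq`). As `K` is bounded, and the singular points are
limits of points with `λ > 0`, `Λ` vanishes on the singular set; as `K ≠ 0`, it vanishes nowhere
else. So the singular curve is the parabolic curve (`IsFront.discriminant_eq_zero_iff`).

In the normal form `(u, v³ + uv)` of a cusp the singular set is `u = -3v²`, with image
`(-3v², -2v³)`. Hence `ν ∘ γ` has an ordinary cusp, by nothing more than the one-variable inverse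
function theorem (`IsCuspOfMap.isOrdinaryCusp_comp`).

In adapted coordinates let `N`, `T = f_u`, `H = f_vv` be restricted to the `u`-axis. Both `T` and
`H` are orthogonal to `N`. The front condition makes `ν_v` a non-zero multiple of `N × T`, and
`Λ = 0` makes `N'` a multiple of `ν_v`, so that `N' = r (N × T)` for a function `r`
(`deriv_eq_rotationRate_smul`). Two computations then carry the theorem:

* `κ_t = -r` (`cuspidalTorsion_eq_neg_rotationRate`), because `⟪N, H'⟫ = -⟪N', H⟫` and
  `⟪N, T'⟫ = -⟪N', T⟫ = 0`;
* `c = N ∘ a`, where `a` is the `u`-coordinate of `γ`, has a critical point at `0`, so `r 0 = 0`,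
  `c'' = a'² r' (N × T)` and `det(c, c'', c''') = 2 a'⁵ r'² det(T, T', N)` (`derivs_comp_axis`).

Since the cusp is ordinary, `c'' ≠ 0`, that is `r' ≠ 0`. The quotient defining the cuspidal
curvature becomes `2 sgn(a') det(T, T', N) / (|T|³ √(|r'| / |T|))`, and `sgn(a')` is the sign of
`∂_v λ` because `λ > 0` on the left of `γ` (`IsAdapted.sign_pv_signedAreaDensity`).
-/

namespace FrontSurface

/-! ### Vector algebra in Euclidean 3-space -/

lemma inner_E3 (a b : E3) : ⟪a, b⟫ = a 0 * b 0 + a 1 * b 1 + a 2 * b 2 := by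
  simp [PiLp.inner_apply, Fin.sum_univ_three, mul_comm]

lemma norm_sq_E3 (a : E3) : ‖a‖ ^ 2 = a 0 ^ 2 + a 1 ^ 2 + a 2 ^ 2 := by
  rw [← real_inner_self_eq_norm_sq, inner_E3]; ring

lemma cross_apply_zero (a b : E3) : cross a b 0 = a 1 * b 2 - a 2 * b 1 := by
  simp [cross, cross_apply]

lemma cross_apply_one (a b : E3) : cross a b 1 = a 2 * b 0 - a 0 * b 2 := by
  simp [cross, cross_apply]

lemma cross_apply_two (a b : E3) : cross a b 2 = a 0 * b 1 - a 1 * b 0 := by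
  simp [cross, cross_apply]

lemma det3_eq (a b c : E3) : det3 a b c = a 0 * b 1 * c 2 - a 0 * b 2 * c 1 - a 1 * b 0 * c 2
    + a 1 * b 2 * c 0 + a 2 * b 0 * c 1 - a 2 * b 1 * c 0 := by
  rw [det3, Matrix.det_fin_three]; simp

lemma det3_eq_inner_cross (a b c : E3) : det3 a b c = ⟪cross a b, c⟫ := by
  rw [det3_eq, inner_E3, cross_apply_zero, cross_apply_one, cross_apply_two]; ring

lemma det3_eq_inner_cross' (a b c : E3) : det3 a b c = ⟪b, cross c a⟫ := by
  rw [det3_eq, inner_E3, cross_apply_zero, cross_apply_one, cross_apply_two]; ring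

lemma E3_ext {a b : E3} (h0 : a 0 = b 0) (h1 : a 1 = b 1) (h2 : a 2 = b 2) : a = b := by
  ext i; fin_cases i <;> assumption

lemma norm_cross_sq (a b : E3) : ‖cross a b‖ ^ 2 = ‖a‖ ^ 2 * ‖b‖ ^ 2 - ⟪a, b⟫ ^ 2 := by
  simp only [norm_sq_E3, inner_E3, cross_apply_zero, cross_apply_one, cross_apply_two]; ring

lemma cross_cross_self (n t : E3) : cross n (cross n t) = ⟪n, t⟫ • n - ‖n‖ ^ 2 • t := by
  apply E3_ext <;>
  · simp only [norm_sq_E3, inner_E3, cross_apply_zero, cross_apply_one, cross_apply_two,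
      PiLp.sub_apply, PiLp.smul_apply, smul_eq_mul]
    ring

lemma cross_eq_smul {a b n : E3} (ha : ⟪a, n⟫ = 0) (hb : ⟪b, n⟫ = 0) (hn : ‖n‖ = 1) :
    cross a b = det3 a b n • n := by
  have h1 : ‖n‖ ^ 2 = 1 := by rw [hn]; norm_num
  rw [norm_sq_E3] at h1
  rw [inner_E3] at ha hb
  apply E3_ext <;>
  simp only [det3_eq, cross_apply_zero, cross_apply_one, cross_apply_two, PiLp.smul_apply,
    smul_eq_mul]
  · linear_combination (-(a 1 * b 2 - a 2 * b 1)) * h1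
      - (n 2 * b 1 - n 1 * b 2) * ha - (n 1 * a 2 - n 2 * a 1) * hb
  · linear_combination (-(a 2 * b 0 - a 0 * b 2)) * h1
      - (n 0 * b 2 - n 2 * b 0) * ha - (n 2 * a 0 - n 0 * a 2) * hb
  · linear_combination (-(a 0 * b 1 - a 1 * b 0)) * h1
      - (n 1 * b 0 - n 0 * b 1) * ha - (n 0 * a 1 - n 1 * a 0) * hb

lemma eq_smul_cross {x n t : E3} (hxn : ⟪x, n⟫ = 0) (hxt : ⟪x, t⟫ = 0) (htn : ⟪t, n⟫ = 0)
    (hn : ‖n‖ = 1) (ht : t ≠ 0) : x = (⟪x, cross n t⟫ / ‖t‖ ^ 2) • cross n t := by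
  have ht2 : ‖t‖ ^ 2 ≠ 0 := by positivity
  have h1 : cross t x = det3 t x n • n := cross_eq_smul htn hxn hn
  have h2 : ‖t‖ ^ 2 • x = det3 t x n • cross n t := by
    have e1 : ‖t‖ ^ 2 • x = cross (cross t x) t := by
      have hxt' := hxt
      rw [inner_E3] at hxt'
      apply E3_ext <;>
      simp only [norm_sq_E3, cross_apply_zero, cross_apply_one, cross_apply_two, PiLp.smul_apply,
        smul_eq_mul]
      · linear_combination t 0 * hxt'
      · linear_combination t 1 * hxt'
      · linear_combination t 2 * hxt'
    rw [e1, h1]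
    apply E3_ext <;>
    · simp only [cross_apply_zero, cross_apply_one, cross_apply_two, PiLp.smul_apply, smul_eq_mul]
      ring
  rw [← det3_eq_inner_cross', div_eq_inv_mul, mul_smul, ← h2, smul_smul, inv_mul_cancel₀ ht2,
    one_smul]

/-- Two tangent vectors of the sphere with vanishing area are linearly dependent. -/
lemma exists_combination_eq_zero {a b n : E3} (ha : ⟪a, n⟫ = 0) (hb : ⟪b, n⟫ = 0) (hn : ‖n‖ = 1)
    (h : det3 a b n = 0) : ∃ x y : ℝ, (x ≠ 0 ∨ y ≠ 0) ∧ x • a + y • b = 0 := by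
  have h0 : cross a b = 0 := by rw [cross_eq_smul ha hb hn, h, zero_smul]
  by_contra! hc
  have hli : LinearIndependent ℝ ![a.ofLp, b.ofLp] := by
    rw [LinearIndependent.pair_iff]
    intro s t hst
    by_contra hne
    refine hc s t (by tauto) ?_
    ext i
    simpa using congrFun hst i
  refine crossProduct_ne_zero_iff_linearIndependent.2 hli ?_
  simpa [cross] using h0

lemma cross_ne_zero {a b : E3} (h : ∀ x y : ℝ, x • a + y • b = 0 → x = 0 ∧ y = 0) :
    cross a b ≠ 0 := by
  have hli : LinearIndependent ℝ ![a.ofLp, b.ofLp] := by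
    rw [LinearIndependent.pair_iff]
    intro s t hst
    refine h s t ?_
    ext i
    simpa using congrFun hst i
  have := crossProduct_ne_zero_iff_linearIndependent.2 hli
  simpa [cross] using this

lemma det3_combination (a b n : E3) (x y z w : ℝ) :
    det3 (x • a + y • b) (z • a + w • b) n = (x * w - z * y) * det3 a b n := by
  simp only [det3_eq, PiLp.add_apply, PiLp.smul_apply, smul_eq_mul]; ring

lemma det_eq_entries (L : ℝ × ℝ →L[ℝ] ℝ × ℝ) :
    L.det = (L (1, 0)).1 * (L (0, 1)).2 - (L (0, 1)).1 * (L (1, 0)).2 := by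
  rw [ContinuousLinearMap.det, ← LinearMap.det_toMatrix (Module.Basis.finTwoProd ℝ),
    Matrix.det_fin_two]
  simp [LinearMap.toMatrix_apply]

/-! ### Calculus helpers -/

lemma contDiffAt_cross {E : Type*} [NormedAddCommGroup E] [NormedSpace ℝ E] {a b : E → E3} {x : E}
    (ha : ContDiffAt ℝ ∞ a x) (hb : ContDiffAt ℝ ∞ b x) :
    ContDiffAt ℝ ∞ (fun y => cross (a y) (b y)) x := by
  have ha' := fun i => contDiffAt_euclidean.1 ha i
  have hb' := fun i => contDiffAt_euclidean.1 hb i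
  rw [contDiffAt_euclidean]
  intro i
  fin_cases i
  · simpa only [Fin.zero_eta, cross_apply_zero] using
      ((ha' 1).mul (hb' 2)).sub ((ha' 2).mul (hb' 1))
  · simpa only [Fin.mk_one, cross_apply_one] using
      ((ha' 2).mul (hb' 0)).sub ((ha' 0).mul (hb' 2))
  · simpa only [Fin.reduceFinMk, cross_apply_two] using
      ((ha' 0).mul (hb' 1)).sub ((ha' 1).mul (hb' 0))

lemma contDiffAt_det3 {E : Type*} [NormedAddCommGroup E] [NormedSpace ℝ E] {a b c : E → E3} {x : E}
    (ha : ContDiffAt ℝ ∞ a x) (hb : ContDiffAt ℝ ∞ b x) (hc : ContDiffAt ℝ ∞ c x) :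
    ContDiffAt ℝ ∞ (fun y => det3 (a y) (b y) (c y)) x := by
  simp only [det3_eq_inner_cross]
  exact (contDiffAt_cross ha hb).inner ℝ hc

lemma contDiffAt_deriv {F : Type*} [NormedAddCommGroup F] [NormedSpace ℝ F] {w : ℝ → F} {t : ℝ}
    (hw : ContDiffAt ℝ ∞ w t) : ContDiffAt ℝ ∞ (deriv w) t := by
  have h : ContDiffAt ℝ ∞ (fderiv ℝ w) t := hw.fderiv_right (by simp)
  exact h.clm_apply contDiffAt_const

lemma contDiffAt_eventually_differentiableAt {E F : Type*} [NormedAddCommGroup E] [NormedSpace ℝ E]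
    [NormedAddCommGroup F] [NormedSpace ℝ F] {w : E → F} {t : E}
    (hw : ContDiffAt ℝ ∞ w t) : ∀ᶠ s in 𝓝 t, DifferentiableAt ℝ w s :=
  ((hw.of_le (m := 1) (by simp)).eventually (by simp)).mono
    fun _ h => h.differentiableAt (by simp)

section Composition

variable {E G : Type*} [NormedAddCommGroup E] [NormedSpace ℝ E] [NormedAddCommGroup G]
  [NormedSpace ℝ G]

/-- At a critical point of the curve `w`, the second derivative of `F ∘ w` is the image of that of
`w` by the differential of `F`. -/
lemma deriv_deriv_comp_of_deriv_eq_zero {F : E → G} {w : ℝ → E} {t : ℝ}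
    (hF : ContDiffAt ℝ ∞ F (w t)) (hw : ContDiffAt ℝ ∞ w t) (h0 : deriv w t = 0) :
    deriv (deriv fun s => F (w s)) t = fderiv ℝ F (w t) (deriv (deriv w) t) := by
  have h1 : deriv (fun s => F (w s)) =ᶠ[𝓝 t] fun s => fderiv ℝ F (w s) (deriv w s) := by
    filter_upwards [hw.continuousAt.eventually (contDiffAt_eventually_differentiableAt hF),
      contDiffAt_eventually_differentiableAt hw] with s hs1 hs2
    exact (hs1.hasFDerivAt.comp_hasDerivAt s hs2.hasDerivAt).deriv
  rw [h1.deriv_eq]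
  have hF' : ContDiffAt ℝ ∞ (fderiv ℝ F) (w t) := hF.fderiv_right (by simp)
  have h2 : HasDerivAt (fun s => fderiv ℝ F (w s)) _ t :=
    ((hF'.differentiableAt (by simp)).hasFDerivAt.comp_hasDerivAt t
      (hw.differentiableAt (by simp)).hasDerivAt)
  have h3 := h2.clm_apply ((contDiffAt_deriv hw).differentiableAt (by simp)).hasDerivAt
  rw [h3.deriv, h0]
  simp

lemma deriv_comp_eq {F : E → G} {w : ℝ → E} {t : ℝ}
    (hF : ContDiffAt ℝ ∞ F (w t)) (hw : ContDiffAt ℝ ∞ w t) :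
    deriv (fun s => F (w s)) t = fderiv ℝ F (w t) (deriv w t) :=
  ((hF.differentiableAt (by simp)).hasFDerivAt.comp_hasDerivAt t
    (hw.differentiableAt (by simp)).hasDerivAt).deriv

end Composition

section Partial

variable {F : Type*} [NormedAddCommGroup F] [NormedSpace ℝ F] {g : ℝ × ℝ → F} {q : ℝ × ℝ}

lemma hasDerivAt_mk_left (q : ℝ × ℝ) : HasDerivAt (fun s : ℝ => (s, q.2)) ((1, 0) : ℝ × ℝ) q.1 :=
  (hasDerivAt_id q.1).prodMk (hasDerivAt_const q.1 q.2)

lemma hasDerivAt_mk_right (q : ℝ × ℝ) : HasDerivAt (fun s : ℝ => (q.1, s)) ((0, 1) : ℝ × ℝ) q.2 :=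
  (hasDerivAt_const q.2 q.1).prodMk (hasDerivAt_id q.2)

lemma hasDerivAt_pu (h : DifferentiableAt ℝ g q) :
    HasDerivAt (fun s : ℝ => g (s, q.2)) (fderiv ℝ g q (1, 0)) q.1 :=
  HasFDerivAt.comp_hasDerivAt (x := q.1) (f := fun s : ℝ => (s, q.2)) (l := g)
    (by exact h.hasFDerivAt) (hasDerivAt_mk_left q)

lemma hasDerivAt_pv (h : DifferentiableAt ℝ g q) :
    HasDerivAt (fun s : ℝ => g (q.1, s)) (fderiv ℝ g q (0, 1)) q.2 :=
  HasFDerivAt.comp_hasDerivAt (x := q.2) (f := fun s : ℝ => (q.1, s)) (l := g)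
    (by exact h.hasFDerivAt) (hasDerivAt_mk_right q)

lemma pu_eq (h : DifferentiableAt ℝ g q) : pu g q = fderiv ℝ g q (1, 0) := (hasDerivAt_pu h).deriv

lemma pv_eq (h : DifferentiableAt ℝ g q) : pv g q = fderiv ℝ g q (0, 1) := (hasDerivAt_pv h).deriv

lemma fderiv_eq_partials (h : DifferentiableAt ℝ g q) (x y : ℝ) :
    fderiv ℝ g q (x, y) = x • pu g q + y • pv g q := by
  rw [pu_eq h, pv_eq h, ← map_smul, ← map_smul, ← map_add]
  simp

lemma contDiffAt_pu (h : ContDiffAt ℝ ∞ g q) : ContDiffAt ℝ ∞ (pu g) q := by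
  have h1 : ContDiffAt ℝ ∞ (fderiv ℝ g) q := h.fderiv_right (by simp)
  refine (h1.clm_apply (contDiffAt_const (c := ((1, 0) : ℝ × ℝ)))).congr_of_eventuallyEq ?_
  filter_upwards [contDiffAt_eventually_differentiableAt h] with x hx using pu_eq hx

lemma contDiffAt_pv (h : ContDiffAt ℝ ∞ g q) : ContDiffAt ℝ ∞ (pv g) q := by
  have h1 : ContDiffAt ℝ ∞ (fderiv ℝ g) q := h.fderiv_right (by simp)
  refine (h1.clm_apply (contDiffAt_const (c := ((0, 1) : ℝ × ℝ)))).congr_of_eventuallyEq ?_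
  filter_upwards [contDiffAt_eventually_differentiableAt h] with x hx using pv_eq hx

/-- Symmetry of second partial derivatives. -/
lemma pv_pu_eq_pu_pv (h : ContDiffAt ℝ ∞ g q) : pv (pu g) q = pu (pv g) q := by
  have h1 : DifferentiableAt ℝ (fderiv ℝ g) q :=
    (h.fderiv_right (m := ∞) (by simp)).differentiableAt (by simp)
  have e1 : pu g =ᶠ[𝓝 q] fun x => fderiv ℝ g x (1, 0) := by
    filter_upwards [contDiffAt_eventually_differentiableAt h] with x hx using pu_eq hx
  have e2 : pv g =ᶠ[𝓝 q] fun x => fderiv ℝ g x (0, 1) := by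
    filter_upwards [contDiffAt_eventually_differentiableAt h] with x hx using pv_eq hx
  rw [pv_eq ((contDiffAt_pu h).differentiableAt (by simp)),
    pu_eq ((contDiffAt_pv h).differentiableAt (by simp)), e1.fderiv_eq, e2.fderiv_eq,
    fderiv_clm_apply h1 (by fun_prop), fderiv_clm_apply h1 (by fun_prop)]
  simp only [fderiv_fun_const, Pi.zero_apply, ContinuousLinearMap.comp_zero, zero_add,
    ContinuousLinearMap.flip_apply]
  exact (h.isSymmSndFDerivAt (by simp [ENat.LEInfty.out])) _ _

end Partial

/-! ### Cuspidal curvature of a spherical curve -/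

/-- At a critical point the tangential projections in the definition of the cuspidal curvature
do not contribute. -/
lemma cuspidalCurvature_of_deriv_eq_zero {c : ℝ → S2} {t : ℝ}
    (hc : ContDiffAt ℝ ∞ (fun s => (c s : E3)) t) (h0 : deriv (fun s => (c s : E3)) t = 0) :
    cuspidalCurvature c t =
      det3 (c t) (deriv (deriv fun s => (c s : E3)) t)
        (deriv (deriv (deriv fun s => (c s : E3))) t) /
      ‖deriv (deriv fun s => (c s : E3)) t‖ ^ (5 / 2 : ℝ) := by
  set C : ℝ → E3 := fun s => (c s : E3) with hC
  have hv : velocity c = deriv C := rfl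
  have hC1 : ContDiffAt ℝ ∞ (deriv C) t := contDiffAt_deriv hc
  have hC2 : ContDiffAt ℝ ∞ (deriv (deriv C)) t := contDiffAt_deriv hC1
  have hunit : ∀ s, ⟪C s, C s⟫ = 1 := fun s => by
    rw [real_inner_self_eq_norm_sq]; simp [hC]
  have horth : ∀ᶠ s in 𝓝 t, ⟪deriv C s, C s⟫ = 0 := by
    filter_upwards [contDiffAt_eventually_differentiableAt hc] with s hs
    have h1 := hs.hasDerivAt.inner ℝ hs.hasDerivAt
    have h2 : HasDerivAt (fun s => ⟪C s, C s⟫) 0 s := by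
      simp only [hunit]; exact hasDerivAt_const _ _
    have h3 := h1.unique h2
    rw [real_inner_comm] at h3
    linarith
  have horth2 : ⟪deriv (deriv C) t, C t⟫ = 0 := by
    have h1 := (hC1.differentiableAt (by simp)).hasDerivAt.inner ℝ
      (hc.differentiableAt (by simp)).hasDerivAt
    have h2 : HasDerivAt (fun s => ⟪deriv C s, C s⟫) 0 t :=
      (hasDerivAt_const t (0 : ℝ)).congr_of_eventuallyEq horth
    have h3 := h1.unique h2
    rw [h0, inner_zero_left] at h3
    linarith
  have hD1 : covDeriv c (velocity c) =
      fun s => deriv (deriv C) s - ⟪deriv (deriv C) s, C s⟫ • C s :=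
    rfl
  have hD1t : covDeriv c (velocity c) t = deriv (deriv C) t := by
    rw [hD1]; simp [horth2]
  have hinner : HasDerivAt (fun s => ⟪deriv (deriv C) s, C s⟫)
      (deriv (fun s => ⟪deriv (deriv C) s, C s⟫) t) t :=
    ((hC2.inner ℝ hc).differentiableAt (by simp)).hasDerivAt
  have hD2 : deriv (covDeriv c (velocity c)) t =
      deriv (deriv (deriv C)) t - deriv (fun s => ⟪deriv (deriv C) s, C s⟫) t • C t := by
    rw [hD1]
    have h := (hC2.differentiableAt (by simp)).hasDerivAt.sub
      (hinner.smul (hc.differentiableAt (by simp)).hasDerivAt)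
    rw [h0, smul_zero, zero_add] at h
    exact h.deriv
  have hdet : ∀ (a b x : E3) (k l : ℝ), det3 a b (x - k • a - l • a) = det3 a b x := by
    intro a b x k l
    simp only [det3_eq, PiLp.sub_apply, PiLp.smul_apply, smul_eq_mul]; ring
  rw [cuspidalCurvature, hD1t]
  congr 1
  have h5 : covDeriv c (covDeriv c (velocity c)) t = deriv (deriv (deriv C)) t
      - deriv (fun s => ⟪deriv (deriv C) s, C s⟫) t • C t
      - ⟪deriv (covDeriv c (velocity c)) t, C t⟫ • C t := by
    conv_lhs => rw [covDeriv]
    rw [hD2]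
  rw [h5]
  exact hdet _ _ _ _ _

/-! ### The Gauss map along the singular axis -/

/-- The data of a front along the axis of an adapted coordinate system, on the part of the axis
where the singularity is a cuspidal edge and the Gauss map is singular: `N` is the Gauss map, `T`
the derivative of the front along the axis, and `H` its second derivative in the null direction. -/
structure IsSingularAxisFrame (N T H : ℝ → E3) (u : ℝ) : Prop where
  smooth_N : ContDiffAt ℝ ∞ N u
  smooth_T : ContDiffAt ℝ ∞ T u
  smooth_H : ContDiffAt ℝ ∞ H u
  unit : ‖N u‖ = 1
  T_orth : ⟪T u, N u⟫ = 0
  H_orth : ⟪H u, N u⟫ = 0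
  deriv_orth : ⟪deriv N u, T u⟫ = 0
  T_ne : T u ≠ 0
  cross_ne : cross (T u) (H u) ≠ 0

/-- The speed of rotation of the Gauss map `N` about the tangent `T` of the singular axis:
`N' = rotationRate • (N × T)`. -/
noncomputable def rotationRate (N T : ℝ → E3) (u : ℝ) : ℝ :=
  ⟪deriv N u, cross (N u) (T u)⟫ / ‖T u‖ ^ 2

section Axis

variable {N T H : ℝ → E3}

lemma inner_deriv_add {a b : ℝ → E3} {u : ℝ} (ha : DifferentiableAt ℝ a u)
    (hb : DifferentiableAt ℝ b u) (h : ∀ᶠ s in 𝓝 u, ⟪a s, b s⟫ = 0) :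
    ⟪a u, deriv b u⟫ + ⟪deriv a u, b u⟫ = 0 :=
  (ha.hasDerivAt.inner ℝ hb.hasDerivAt).unique
    ((hasDerivAt_const u (0 : ℝ)).congr_of_eventuallyEq h)

lemma deriv_inner_self_of_unit {u : ℝ} (hN : DifferentiableAt ℝ N u)
    (h : ∀ᶠ s in 𝓝 u, ‖N s‖ = 1) : ⟪deriv N u, N u⟫ = 0 := by
  have h1 := hN.hasDerivAt.inner ℝ hN.hasDerivAt
  have h2 : HasDerivAt (fun s => ⟪N s, N s⟫) 0 u := by
    refine (hasDerivAt_const u (1 : ℝ)).congr_of_eventuallyEq ?_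
    filter_upwards [h] with s hs
    rw [real_inner_self_eq_norm_sq, hs]; norm_num
  have h3 := h1.unique h2
  rw [real_inner_comm] at h3
  linarith

lemma deriv_eq_rotationRate_smul {u : ℝ} (h : ∀ᶠ s in 𝓝 u, IsSingularAxisFrame N T H s) :
    deriv N u = rotationRate N T u • cross (N u) (T u) := by
  have hu := h.self_of_nhds
  exact eq_smul_cross (deriv_inner_self_of_unit (hu.smooth_N.differentiableAt (by simp))
    (h.mono fun s hs => hs.unit)) hu.deriv_orth hu.T_orth hu.unit hu.T_ne

lemma contDiffAt_rotationRate {u : ℝ} (h : IsSingularAxisFrame N T H u) :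
    ContDiffAt ℝ ∞ (rotationRate N T) u := by
  have h1 : ContDiffAt ℝ ∞ (fun s => ‖T s‖ ^ 2) u := by
    simp only [← real_inner_self_eq_norm_sq]
    exact h.smooth_T.inner ℝ h.smooth_T
  refine ((contDiffAt_deriv h.smooth_N).inner ℝ (contDiffAt_cross h.smooth_N h.smooth_T)).div h1 ?_
  have := h.T_ne
  positivity

/-- The cuspidal torsion is minus the rate of rotation of the Gauss map about the singular axis. -/
lemma cuspidalTorsion_eq_neg_rotationRate {u : ℝ}
    (h : ∀ᶠ s in 𝓝 u, IsSingularAxisFrame N T H s) :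
    det3 (T u) (H u) (deriv H u) / ‖cross (T u) (H u)‖ ^ 2
      - ⟪T u, H u⟫ * det3 (T u) (H u) (deriv T u) / (‖T u‖ ^ 2 * ‖cross (T u) (H u)‖ ^ 2)
      = - rotationRate N T u := by
  have hu := h.self_of_nhds
  have hN' := deriv_eq_rotationRate_smul h
  have hT := inner_deriv_add (hu.smooth_T.differentiableAt (by simp))
    (hu.smooth_N.differentiableAt (by simp)) (h.mono fun s hs => hs.T_orth)
  have hH := inner_deriv_add (hu.smooth_H.differentiableAt (by simp))
    (hu.smooth_N.differentiableAt (by simp)) (h.mono fun s hs => hs.H_orth)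
  rw [real_inner_comm, hu.deriv_orth, zero_add] at hT
  have hc := cross_eq_smul hu.T_orth hu.H_orth hu.unit
  set s := det3 (T u) (H u) (N u) with hs
  have hs0 : s ≠ 0 := fun h0 => hu.cross_ne (by rw [hc, h0, zero_smul])
  rw [hN', inner_smul_right, ← det3_eq_inner_cross', ← hs] at hH
  rw [det3_eq_inner_cross, det3_eq_inner_cross, hc, inner_smul_left, inner_smul_left,
    norm_smul, hu.unit, mul_one, real_inner_comm, real_inner_comm (deriv T u), hT]
  simp only [conj_trivial, mul_zero, zero_div, sub_zero, Real.norm_eq_abs, sq_abs]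
  field_simp
  linarith

/-- Second and third derivatives of `N ∘ a` at a zero of the derivative of `N`. -/
lemma derivs_comp_axis {a : ℝ → ℝ} (ha : ContDiffAt ℝ ∞ a 0) (ha0 : a 0 = 0)
    (h : ∀ᶠ u in 𝓝 (0 : ℝ), IsSingularAxisFrame N T H u) (hr0 : rotationRate N T 0 = 0) :
    deriv (deriv fun t => N (a t)) 0 =
        (deriv a 0 ^ 2 * deriv (rotationRate N T) 0) • cross (N 0) (T 0) ∧
    det3 (N 0) (deriv (deriv fun t => N (a t)) 0) (deriv (deriv (deriv fun t => N (a t))) 0) =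
      2 * deriv a 0 ^ 5 * deriv (rotationRate N T) 0 ^ 2 * det3 (T 0) (deriv T 0) (N 0) := by
  have hu := h.self_of_nhds
  set r := rotationRate N T with hr
  have hat : Tendsto a (𝓝 0) (𝓝 0) := by simpa [ContinuousAt, ha0] using ha.continuousAt
  set W : ℝ → E3 := fun t => cross (N (a t)) (T (a t)) with hW
  set k : ℝ → ℝ := fun t => deriv a t * r (a t) with hk
  have hrc : ContDiffAt ℝ ∞ r (a 0) := by rw [ha0]; exact contDiffAt_rotationRate hu
  have hNc : ContDiffAt ℝ ∞ N (a 0) := by rw [ha0]; exact hu.smooth_N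
  have hTc : ContDiffAt ℝ ∞ T (a 0) := by rw [ha0]; exact hu.smooth_T
  have hWc : ContDiffAt ℝ ∞ W 0 := contDiffAt_cross (hNc.comp 0 ha) (hTc.comp 0 ha)
  have hkc : ContDiffAt ℝ ∞ k 0 := (contDiffAt_deriv ha).mul (hrc.comp 0 ha)
  have hk0 : k 0 = 0 := by simp [hk, ha0, hr0]
  have hk1 : deriv k 0 = deriv a 0 ^ 2 * deriv r 0 := by
    have h1 := ((contDiffAt_deriv ha).differentiableAt (by simp)).hasDerivAt.mul
      (HasDerivAt.comp 0 (hrc.differentiableAt (by simp)).hasDerivAt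
        (ha.differentiableAt (by simp)).hasDerivAt)
    have h2 : deriv k 0 = _ := h1.deriv
    rw [h2]; simp [ha0, hr0]; ring
  have hC1 : deriv (fun t => N (a t)) =ᶠ[𝓝 0] fun t => k t • W t := by
    filter_upwards [hat.eventually h.eventually_nhds, contDiffAt_eventually_differentiableAt ha]
      with t ht hat
    have h1 := HasDerivAt.scomp t (ht.self_of_nhds.smooth_N.differentiableAt (by simp)).hasDerivAt
      hat.hasDerivAt
    have h2 : deriv (fun t => N (a t)) t = _ := h1.deriv
    rw [h2, deriv_eq_rotationRate_smul ht, smul_smul]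
  have hC2 : deriv (deriv fun t => N (a t)) =ᶠ[𝓝 0] fun t => k t • deriv W t + deriv k t • W t := by
    filter_upwards [hC1.eventuallyEq_nhds, contDiffAt_eventually_differentiableAt hWc,
      contDiffAt_eventually_differentiableAt hkc] with t h1 h2 h3
    rw [h1.deriv_eq]
    exact (h3.hasDerivAt.smul h2.hasDerivAt).deriv
  have hW0 : W 0 = cross (N 0) (T 0) := by simp [hW, ha0]
  have hC20 : deriv (deriv fun t => N (a t)) 0 =
      (deriv a 0 ^ 2 * deriv r 0) • cross (N 0) (T 0) := by
    refine hC2.self_of_nhds.trans ?_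
    simp only [hk0, hk1, hW0, zero_smul, zero_add]
  refine ⟨hC20, ?_⟩
  have hC3 : deriv (deriv (deriv fun t => N (a t))) 0 =
      (2 * deriv k 0) • deriv W 0 + deriv (deriv k) 0 • W 0 := by
    rw [hC2.deriv_eq]
    have h1 := ((hkc.differentiableAt (by simp)).hasDerivAt.smul
      ((contDiffAt_deriv hWc).differentiableAt (by simp)).hasDerivAt).add
      (((contDiffAt_deriv hkc).differentiableAt (by simp)).hasDerivAt.smul
        (hWc.differentiableAt (by simp)).hasDerivAt)
    have h2 : deriv (fun t => k t • deriv W t + deriv k t • W t) 0 = _ := h1.deriv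
    rw [h2, hk0, zero_smul, zero_add, two_mul, add_smul]
    abel
  -- `W` stays orthogonal to `T ∘ a`, which gives the only component of `W'` that is needed.
  have hTW : ⟪T 0, deriv W 0⟫ = - (deriv a 0 * ⟪deriv T 0, cross (N 0) (T 0)⟫) := by
    have h1 := inner_deriv_add (a := fun t => T (a t)) (b := W)
      ((hTc.comp 0 ha).differentiableAt (by simp)) (hWc.differentiableAt (by simp))
      (Eventually.of_forall fun t => by
        simp only [hW, ← det3_eq_inner_cross']; rw [det3_eq]; ring)
    have h2 : deriv (fun t => T (a t)) 0 = _ := (HasDerivAt.scomp 0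
      (hTc.differentiableAt (by simp)).hasDerivAt (ha.differentiableAt (by simp)).hasDerivAt).deriv
    rw [h2, inner_smul_left, hW0, ha0] at h1
    simp only [conj_trivial] at h1
    linarith
  have hdet : ∀ (n w v : E3) (x y z : ℝ),
      det3 n (x • w) (y • v + z • w) = x * y * ⟪cross n w, v⟫ := by
    intro n w v x y z
    rw [← det3_eq_inner_cross]
    simp only [det3_eq, PiLp.add_apply, PiLp.smul_apply, smul_eq_mul]; ring
  have hNT : ⟪N 0, T 0⟫ = 0 := by rw [real_inner_comm]; exact hu.T_orth
  rw [hC3, hC20, hW0, hdet, cross_cross_self, hNT, hu.unit, hk1]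
  simp only [zero_smul, one_pow, one_smul, zero_sub, inner_neg_left, hTW, neg_neg]
  rw [det3_eq_inner_cross']
  ring

end Axis

lemma cuspidal_quotient_identity {a r T d : ℝ} (ha : a ≠ 0) (hr : r ≠ 0) (hT : 0 < T) :
    2 * a ^ 5 * r ^ 2 * d / (a ^ 2 * |r| * T) ^ (5 / 2 : ℝ) =
      2 * ((SignType.sign a : ℝ) * (d / T ^ 3)) / √(|r| / T) := by
  have hr' : 0 < |r| := abs_pos.2 hr
  have ha' : 0 < |a| := abs_pos.2 ha
  have hx : 0 < a ^ 2 * |r| * T := by positivity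
  have h1 : (a ^ 2 * |r| * T) ^ (5 / 2 : ℝ) = (a ^ 2 * |r| * T) ^ 2 * (|a| * √|r| * √T) := by
    rw [show (5 / 2 : ℝ) = (2 : ℕ) + 1 / 2 by norm_num, Real.rpow_add hx, Real.rpow_natCast,
      ← Real.sqrt_eq_rpow, Real.sqrt_mul (by positivity), Real.sqrt_mul (by positivity),
      Real.sqrt_sq_eq_abs]
  have hsr : 0 < √|r| := Real.sqrt_pos.2 hr'
  have hsT : 0 < √T := Real.sqrt_pos.2 hT
  have hT2 : √T ^ 2 = T := Real.sq_sqrt hT.le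
  have hr2 : r ^ 2 = |r| ^ 2 := (sq_abs r).symm
  rw [h1, Real.sqrt_div hr'.le, hr2]
  generalize √T = y at *
  subst hT2
  rcases lt_or_gt_of_ne ha with h | h
  · rw [sign_neg h, abs_of_neg h]
    simp only [SignType.coe_neg_one]
    field_simp
  · rw [sign_pos h, abs_of_pos h]
    simp only [SignType.coe_one]
    field_simp

/-! ### Partial diffeomorphisms and `𝒜`-equivalence -/

section PartialDiffeo

variable {E F : Type*} [NormedAddCommGroup E] [NormedSpace ℝ E]
  [NormedAddCommGroup F] [NormedSpace ℝ F]

lemma partialDiffeo_contDiffAt (φ : PartialDiffeomorph 𝓘(ℝ, E) 𝓘(ℝ, F) E F ∞) {x : E}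
    (hx : x ∈ φ.source) : ContDiffAt ℝ ∞ φ x :=
  (contMDiffOn_iff_contDiffOn.1 φ.contMDiffOn).contDiffAt (φ.open_source.mem_nhds hx)

lemma partialDiffeo_symm_contDiffAt (φ : PartialDiffeomorph 𝓘(ℝ, E) 𝓘(ℝ, F) E F ∞) {y : F}
    (hy : y ∈ φ.target) : ContDiffAt ℝ ∞ φ.symm y :=
  partialDiffeo_contDiffAt φ.symm hy

lemma partialDiffeo_left_inv (φ : PartialDiffeomorph 𝓘(ℝ, E) 𝓘(ℝ, F) E F ∞) {x : E}
    (hx : x ∈ φ.source) : φ.symm (φ x) = x := φ.left_inv hx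

lemma partialDiffeo_right_inv (φ : PartialDiffeomorph 𝓘(ℝ, E) 𝓘(ℝ, F) E F ∞) {y : F}
    (hy : y ∈ φ.target) : φ (φ.symm y) = y := φ.right_inv hy

lemma partialDiffeo_map_mem (φ : PartialDiffeomorph 𝓘(ℝ, E) 𝓘(ℝ, F) E F ∞) {x : E}
    (hx : x ∈ φ.source) : φ x ∈ φ.target := φ.map_source hx

lemma partialDiffeo_symm_mem (φ : PartialDiffeomorph 𝓘(ℝ, E) 𝓘(ℝ, F) E F ∞) {y : F}
    (hy : y ∈ φ.target) : φ.symm y ∈ φ.source := φ.map_target hy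

lemma fderiv_symm_apply_fderiv (φ : PartialDiffeomorph 𝓘(ℝ, E) 𝓘(ℝ, F) E F ∞) {x : E}
    (hx : x ∈ φ.source) (v : E) : fderiv ℝ φ.symm (φ x) (fderiv ℝ φ x v) = v := by
  have h1 := ((partialDiffeo_symm_contDiffAt φ (partialDiffeo_map_mem φ hx)).differentiableAt
    (by simp)).hasFDerivAt.comp x
    ((partialDiffeo_contDiffAt φ hx).differentiableAt (by simp)).hasFDerivAt
  have h2 : HasFDerivAt (φ.symm ∘ φ) (ContinuousLinearMap.id ℝ E) x := by
    refine (hasFDerivAt_id x).congr_of_eventuallyEq ?_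
    filter_upwards [φ.open_source.mem_nhds hx] with y hy using partialDiffeo_left_inv φ hy
  exact DFunLike.congr_fun (h1.unique h2) v

lemma fderiv_partialDiffeo_injective (φ : PartialDiffeomorph 𝓘(ℝ, E) 𝓘(ℝ, F) E F ∞) {x : E}
    (hx : x ∈ φ.source) : Function.Injective (fderiv ℝ φ x) :=
  Function.LeftInverse.injective (fderiv_symm_apply_fderiv φ hx)

lemma fderiv_apply_fderiv_symm (φ : PartialDiffeomorph 𝓘(ℝ, E) 𝓘(ℝ, F) E F ∞) {x : E}
    (hx : x ∈ φ.source) (v : F) : fderiv ℝ φ x (fderiv ℝ φ.symm (φ x) v) = v := by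
  have h := fderiv_symm_apply_fderiv φ.symm (partialDiffeo_map_mem φ hx) v
  have e : φ.symm (φ x) = x := partialDiffeo_left_inv φ hx
  rw [e] at h
  exact h

/-- The restriction of a partial diffeomorphism to an open set. -/
noncomputable def restrictOpen (φ : PartialDiffeomorph 𝓘(ℝ, E) 𝓘(ℝ, F) E F ∞) (O : Set E)
    (hO : IsOpen O) : PartialDiffeomorph 𝓘(ℝ, E) 𝓘(ℝ, F) E F ∞ where
  __ := φ.toOpenPartialHomeomorph.restrOpen O hO
  contMDiffOn_toFun := φ.contMDiffOn_toFun.mono inter_subset_left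
  contMDiffOn_invFun := φ.contMDiffOn_invFun.mono inter_subset_left

/-- The inverse function theorem on the real line. -/
lemma exists_partialDiffeo_of_deriv_ne_zero {ψ : ℝ → ℝ} {t : ℝ}
    (hψ : ∀ᶠ s in 𝓝 t, ContDiffAt ℝ ∞ ψ s) (h : deriv ψ t ≠ 0) :
    ∃ P : PartialDiffeomorph 𝓘(ℝ, ℝ) 𝓘(ℝ, ℝ) ℝ ℝ ∞, t ∈ P.source ∧ ∀ s, P s = ψ s := by
  have ht := hψ.self_of_nhds
  have hne : ∀ᶠ s in 𝓝 t, deriv ψ s ≠ 0 := (contDiffAt_deriv ht).continuousAt.eventually_ne h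
  obtain ⟨O, hO, hOo, htO⟩ := eventually_nhds_iff.1 (hψ.and hne)
  have hder : HasFDerivAt ψ
      ((ContinuousLinearEquiv.unitsEquivAut ℝ (Units.mk0 (deriv ψ t) h) : ℝ ≃L[ℝ] ℝ) :
        ℝ →L[ℝ] ℝ) t := by
    exact (ht.differentiableAt (by simp)).hasDerivAt.hasFDerivAt_equiv h
  set e := (ht.toOpenPartialHomeomorph ψ hder (by simp)).restrOpen O hOo with he
  have hcoe : ∀ s, e s = ψ s := fun s => rfl
  refine ⟨{ e with
    contMDiffOn_toFun := ?_
    contMDiffOn_invFun := ?_ }, ⟨ht.mem_toOpenPartialHomeomorph_source hder (by simp), htO⟩,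
    fun s => rfl⟩
  · exact contMDiffOn_iff_contDiffOn.2 fun x hx => (hO x hx.2).1.contDiffWithinAt
  · refine contMDiffOn_iff_contDiffOn.2 fun y hy => ContDiffAt.contDiffWithinAt ?_
    have hx : e.symm y ∈ O := (e.map_target hy).2
    exact e.contDiffAt_symm_deriv (hO _ hx).2 hy
      (((hO _ hx).1.differentiableAt (by simp)).hasDerivAt) (hO _ hx).1

end PartialDiffeo

/-- A map germ that is `𝒜`-equivalent to `g`, seen through an immersion `ι` of the target,
factors as an immersion after `g ∘ φ`, where `φ` is a diffeomorphism germ of the source. -/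
lemma AEquivalentAt.exists_immersion {E F N G : Type*} [NormedAddCommGroup E] [NormedSpace ℝ E]
    [NormedAddCommGroup F] [NormedSpace ℝ F] [TopologicalSpace N] [ChartedSpace F N]
    [NormedAddCommGroup G] [NormedSpace ℝ G] {f : E → N} {p : E} {g : E → F}
    (h : AEquivalentAt f p g) {ι : N → G} (hι : ContMDiff 𝓘(ℝ, F) 𝓘(ℝ, G) ∞ ι)
    (hinj : ∀ x, Function.Injective (mfderiv 𝓘(ℝ, F) 𝓘(ℝ, G) ι x)) :
    ∃ (φ : PartialDiffeomorph 𝓘(ℝ, E) 𝓘(ℝ, E) E E ∞)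
      (Φ : PartialDiffeomorph 𝓘(ℝ, F) 𝓘(ℝ, F) N F ∞) (I : F → G),
      p ∈ φ.source ∧ φ p = 0 ∧ ∀ᶠ x in 𝓝 p, x ∈ φ.source ∧ ι (f x) = I (g (φ x)) ∧
        ContDiffAt ℝ ∞ I (g (φ x)) ∧ Function.Injective (fderiv ℝ I (g (φ x))) ∧
        f x ∈ Φ.source ∧ Φ (f x) = g (φ x) := by
  obtain ⟨φ, Φ, hp, hp0, -, -, hev⟩ := h
  refine ⟨φ, Φ, ι ∘ Φ.symm, hp, hp0, ?_⟩
  filter_upwards [hev, φ.open_source.mem_nhds hp] with x ⟨hx1, hx2⟩ hxs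
  have hy : g (φ x) ∈ Φ.target := hx2 ▸ Φ.map_source hx1
  have hΦs : ContMDiffAt 𝓘(ℝ, F) 𝓘(ℝ, F) ∞ Φ.symm (g (φ x)) :=
    Φ.symm.contMDiffOn.contMDiffAt (Φ.open_target.mem_nhds hy)
  refine ⟨hxs, ?_, ?_, ?_, hx1, hx2⟩
  · rw [← hx2]
    exact congrArg ι (Φ.left_inv hx1).symm
  · exact (hι.contMDiffAt.comp _ hΦs).contDiffAt
  · have hd1 : MDifferentiableAt 𝓘(ℝ, F) 𝓘(ℝ, F) Φ.symm (g (φ x)) :=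
      hΦs.mdifferentiableAt (by simp)
    have hd2 : MDifferentiableAt 𝓘(ℝ, F) 𝓘(ℝ, F) Φ (Φ.symm (g (φ x))) :=
      Φ.mdifferentiableAt (by simp) (Φ.map_target hy)
    have hinv : (mfderiv 𝓘(ℝ, F) 𝓘(ℝ, F) Φ (Φ.symm (g (φ x)))).comp
        (mfderiv 𝓘(ℝ, F) 𝓘(ℝ, F) Φ.symm (g (φ x))) = ContinuousLinearMap.id ℝ F := by
      rw [← mfderiv_comp _ hd2 hd1]
      have : Φ ∘ Φ.symm =ᶠ[𝓝 (g (φ x))] id := by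
        filter_upwards [Φ.open_target.mem_nhds hy] with y hy using Φ.right_inv hy
      rw [this.mfderiv_eq]
      exact mfderiv_id
    have hi1 : Function.Injective (mfderiv 𝓘(ℝ, F) 𝓘(ℝ, F) Φ.symm (g (φ x))) :=
      Function.LeftInverse.injective (fun v => DFunLike.congr_fun hinv v)
    rw [← mfderiv_eq_fderiv, mfderiv_comp _ (hι.mdifferentiableAt (by simp)) hd1]
    exact (hinj _).comp hi1

lemma AEquivalentAt.exists_immersion_sphere {E : Type*} [NormedAddCommGroup E] [NormedSpace ℝ E]
    {f : E → S2} {p : E} {g : E → EuclideanSpace ℝ (Fin 2)} (h : AEquivalentAt f p g) :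
    ∃ (φ : PartialDiffeomorph 𝓘(ℝ, E) 𝓘(ℝ, E) E E ∞)
      (Φ : PartialDiffeomorph 𝓘(ℝ, EuclideanSpace ℝ (Fin 2)) 𝓘(ℝ, EuclideanSpace ℝ (Fin 2))
        S2 (EuclideanSpace ℝ (Fin 2)) ∞) (I : EuclideanSpace ℝ (Fin 2) → E3),
      p ∈ φ.source ∧ φ p = 0 ∧ ∀ᶠ x in 𝓝 p, x ∈ φ.source ∧ (f x : E3) = I (g (φ x)) ∧
        ContDiffAt ℝ ∞ I (g (φ x)) ∧ Function.Injective (fderiv ℝ I (g (φ x))) ∧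
        f x ∈ Φ.source ∧ Φ (f x) = g (φ x) :=
  haveI : Fact (Module.finrank ℝ E3 = 2 + 1) := ⟨by simp⟩
  h.exists_immersion contMDiff_coe_sphere injective_mvfderiv_subtypeVal_sphere

lemma AEquivalentAt.exists_immersion_E3 {E : Type*} [NormedAddCommGroup E] [NormedSpace ℝ E]
    {f : E → E3} {p : E} {g : E → E3} (h : AEquivalentAt f p g) :
    ∃ (φ : PartialDiffeomorph 𝓘(ℝ, E) 𝓘(ℝ, E) E E ∞) (I : E3 → E3),
      p ∈ φ.source ∧ φ p = 0 ∧ ∀ᶠ x in 𝓝 p, x ∈ φ.source ∧ f x = I (g (φ x)) ∧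
        ContDiffAt ℝ ∞ I (g (φ x)) ∧ Function.Injective (fderiv ℝ I (g (φ x))) := by
  obtain ⟨φ, _, I, hp, hp0, hev⟩ := h.exists_immersion (ι := id) contMDiff_id fun x => by
    rw [mfderiv_id]; exact fun a b hab => hab
  exact ⟨φ, I, hp, hp0, hev.mono fun x hx => ⟨hx.1, hx.2.1, hx.2.2.1, hx.2.2.2.1⟩⟩

lemma hasDerivAt_fst {k : ℝ → ℝ × ℝ} {k' : ℝ × ℝ} {t : ℝ} (h : HasDerivAt k k' t) :
    HasDerivAt (fun s => (k s).1) k'.1 t := by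
  simpa using (HasFDerivAt.fst h).hasDerivAt

lemma hasDerivAt_snd {k : ℝ → ℝ × ℝ} {k' : ℝ × ℝ} {t : ℝ} (h : HasDerivAt k k' t) :
    HasDerivAt (fun s => (k s).2) k'.2 t := by
  simpa using (HasFDerivAt.snd h).hasDerivAt

lemma deriv_euclidean_apply {n : ℕ} {w : ℝ → EuclideanSpace ℝ (Fin n)} {t : ℝ}
    (hw : ContDiffAt ℝ ∞ w t) (i : Fin n) : deriv w t i = deriv (fun s => w s i) t := by
  have h := deriv_comp_eq (F := EuclideanSpace.proj (𝕜 := ℝ) i)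
    (ContinuousLinearMap.contDiff _).contDiffAt hw
  rw [ContinuousLinearMap.fderiv] at h
  exact h.symm

lemma deriv_deriv_euclidean_apply {n : ℕ} {w : ℝ → EuclideanSpace ℝ (Fin n)} {t : ℝ}
    (hw : ContDiffAt ℝ ∞ w t) (h0 : deriv w t = 0) (i : Fin n) :
    deriv (deriv w) t i = deriv (deriv (fun s => w s i)) t := by
  have h := deriv_deriv_comp_of_deriv_eq_zero (F := EuclideanSpace.proj (𝕜 := ℝ) i)
    (ContinuousLinearMap.contDiff _).contDiffAt hw h0
  rw [ContinuousLinearMap.fderiv] at h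
  exact h.symm

lemma deriv_deriv_sq {ψ : ℝ → ℝ} {t : ℝ} (h : ContDiffAt ℝ ∞ ψ t) (h0 : ψ t = 0) :
    deriv (deriv fun s => ψ s ^ 2) t = 2 * deriv ψ t ^ 2 := by
  have h1 : deriv (fun s => ψ s ^ 2) =ᶠ[𝓝 t] fun s => 2 * ψ s * deriv ψ s := by
    filter_upwards [contDiffAt_eventually_differentiableAt h] with s hs
    exact (hs.hasDerivAt.pow 2).deriv.trans (by simp)
  rw [h1.deriv_eq]
  have h2 := (((h.differentiableAt (by simp)).hasDerivAt.const_mul 2).mul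
    ((contDiffAt_deriv h).differentiableAt (by simp)).hasDerivAt).deriv
  refine h2.trans ?_
  rw [h0]; ring

/-! ### Ordinary cusps of spherical curves -/

lemma IsOrdinaryCusp.deriv_eq_zero_and {c : ℝ → S2} {t : ℝ} (h : IsOrdinaryCusp c t) :
    deriv (fun s => (c s : E3)) t = 0 ∧ deriv (deriv fun s => (c s : E3)) t ≠ 0 := by
  obtain ⟨ψ, _, I, ht, ht0, hev⟩ := AEquivalentAt.exists_immersion_sphere h
  have hψ : ContDiffAt ℝ ∞ ψ t := partialDiffeo_contDiffAt ψ ht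
  have hψ' : deriv ψ t ≠ 0 := by
    intro h0
    have := fderiv_partialDiffeo_injective ψ ht (a₁ := 1) (a₂ := 0) (by
      rw [map_zero]; exact h0)
    exact one_ne_zero this
  set w : ℝ → EuclideanSpace ℝ (Fin 2) := fun s => !₂[ψ s ^ 2, ψ s ^ 3] with hw
  have hwc : ContDiffAt ℝ ∞ w t := by
    rw [contDiffAt_euclidean]
    intro i
    fin_cases i
    · exact hψ.pow 2
    · exact hψ.pow 3
  have hd := (hψ.differentiableAt (by simp)).hasDerivAt
  have hw0 : deriv w t = 0 := by
    ext i
    rw [deriv_euclidean_apply hwc]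
    fin_cases i
    · exact (hd.pow 2).deriv.trans (by rw [ht0]; simp)
    · exact (hd.pow 3).deriv.trans (by rw [ht0]; simp)
  obtain ⟨-, -, hI, hIi, -⟩ := hev.self_of_nhds
  have heq : (fun s => (c s : E3)) =ᶠ[𝓝 t] fun s => I (w s) := hev.mono fun s hs => hs.2.1
  constructor
  · rw [heq.deriv_eq, deriv_comp_eq hI hwc, hw0, map_zero]
  · rw [heq.deriv.deriv_eq, deriv_deriv_comp_of_deriv_eq_zero hI hwc hw0]
    intro h0
    have h1 : deriv (deriv w) t = 0 := hIi (h0.trans (map_zero _).symm)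
    have h2 := deriv_deriv_euclidean_apply hwc hw0 0
    rw [h1] at h2
    have h3 := deriv_deriv_sq hψ ht0
    have h4 : (0 : ℝ) = deriv (deriv fun s => ψ s ^ 2) t := h2
    rw [h3] at h4
    have : 0 < deriv ψ t ^ 2 := by positivity
    linarith


/-- A curve which in a chart of the sphere is `s ↦ (-3ψ², -2ψ³)`, where `ψ` is a local coordinate of
the line, has an ordinary cusp. -/
lemma IsOrdinaryCusp.of_partialDiffeo {c : ℝ → S2} {t : ℝ}
    (Φ : PartialDiffeomorph 𝓘(ℝ, EuclideanSpace ℝ (Fin 2)) 𝓘(ℝ, EuclideanSpace ℝ (Fin 2))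
      S2 (EuclideanSpace ℝ (Fin 2)) ∞) {ψ : ℝ → ℝ}
    (hψ : ∀ᶠ s in 𝓝 t, ContDiffAt ℝ ∞ ψ s) (hψ0 : ψ t = 0) (hψ' : deriv ψ t ≠ 0)
    (hev : ∀ᶠ s in 𝓝 t, c s ∈ Φ.source ∧ Φ (c s) = !₂[-3 * ψ s ^ 2, -2 * ψ s ^ 3]) :
    IsOrdinaryCusp c t := by
  obtain ⟨P, hP, hPψ⟩ := exists_partialDiffeo_of_deriv_ne_zero hψ hψ'
  let S : PartialDiffeomorph 𝓘(ℝ, EuclideanSpace ℝ (Fin 2)) 𝓘(ℝ, EuclideanSpace ℝ (Fin 2))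
      (EuclideanSpace ℝ (Fin 2)) (EuclideanSpace ℝ (Fin 2)) ∞ :=
    { toFun := fun x => !₂[x 0 / (-3), x 1 / (-2)]
      invFun := fun x => !₂[-3 * x 0, -2 * x 1]
      source := univ
      target := univ
      map_source' := fun _ _ => mem_univ _
      map_target' := fun _ _ => mem_univ _
      left_inv' := fun x _ => by ext i; fin_cases i <;> simp <;> ring
      right_inv' := fun x _ => by ext i; fin_cases i <;> simp
      open_source := isOpen_univ
      open_target := isOpen_univ
      contMDiffOn_toFun := by
        refine contMDiffOn_iff_contDiffOn.2 (ContDiff.contDiffOn ?_)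
        rw [contDiff_euclidean]
        intro i
        fin_cases i
        · exact (EuclideanSpace.proj (𝕜 := ℝ) (0 : Fin 2)).contDiff.div_const _
        · exact (EuclideanSpace.proj (𝕜 := ℝ) (1 : Fin 2)).contDiff.div_const _
      contMDiffOn_invFun := by
        refine contMDiffOn_iff_contDiffOn.2 (ContDiff.contDiffOn ?_)
        rw [contDiff_euclidean]
        intro i
        fin_cases i
        · exact contDiff_const.mul (EuclideanSpace.proj (𝕜 := ℝ) (0 : Fin 2)).contDiff
        · exact contDiff_const.mul (EuclideanSpace.proj (𝕜 := ℝ) (1 : Fin 2)).contDiff }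
  have key : ∀ s, c s ∈ Φ.source → Φ (c s) = !₂[-3 * ψ s ^ 2, -2 * ψ s ^ 3] →
      c s ∈ (Φ.trans S).source ∧ (Φ.trans S) (c s) = !₂[P s ^ 2, P s ^ 3] := by
    intro s h1 h2
    refine ⟨⟨h1, mem_univ _⟩, ?_⟩
    change S (Φ (c s)) = _
    rw [h2, hPψ]
    ext i
    fin_cases i <;> simp [S]
  have ht := hev.self_of_nhds
  have hkt := key t ht.1 ht.2
  refine ⟨P, Φ.trans S, hP, (hPψ t).trans hψ0, hkt.1, ?_, hev.mono fun s hs => key s hs.1 hs.2⟩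
  rw [hkt.2, hPψ, hψ0]
  ext i
  fin_cases i <;> simp

/-! ### The singular set of a cusp of a map -/

lemma hasDerivAt_line {E F : Type*} [NormedAddCommGroup E] [NormedSpace ℝ E]
    [NormedAddCommGroup F] [NormedSpace ℝ F] {h : E → F} {q : E} (hd : DifferentiableAt ℝ h q)
    (Y : E) : HasDerivAt (fun s : ℝ => h (q + s • Y)) (fderiv ℝ h q Y) 0 :=
  hd.hasFDerivAt.hasLineDerivAt Y

lemma contDiffAt_line {E F : Type*} [NormedAddCommGroup E] [NormedSpace ℝ E]
    [NormedAddCommGroup F] [NormedSpace ℝ F] {h : E → F} {q : E} (hd : ContDiffAt ℝ ∞ h q)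
    (Y : E) : ContDiffAt ℝ ∞ (fun s : ℝ => h (q + s • Y)) 0 := by
  have h1 : ContDiffAt ℝ ∞ h (q + (0 : ℝ) • Y) := by simpa using hd
  exact h1.comp (0 : ℝ) (by fun_prop : ContDiffAt ℝ ∞ (fun s : ℝ => q + s • Y) 0)

lemma tendsto_line {E : Type*} [NormedAddCommGroup E] [NormedSpace ℝ E] (q Y : E) :
    Tendsto (fun s : ℝ => q + s • Y) (𝓝 0) (𝓝 q) := by
  have : Continuous (fun s : ℝ => q + s • Y) := by fun_prop
  simpa using this.tendsto 0

/-- In the source coordinates of the normal form `(u, v³ + uv)` of a cusp, the singular points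
satisfy `u = -3 v²`. -/
lemma fst_eq_of_singular_of_cusp_normal_form {n : ℝ × ℝ → E3}
    {φ : PartialDiffeomorph 𝓘(ℝ, ℝ × ℝ) 𝓘(ℝ, ℝ × ℝ) (ℝ × ℝ) (ℝ × ℝ) ∞}
    {I : EuclideanSpace ℝ (Fin 2) → E3} {q Y : ℝ × ℝ} (hq : q ∈ φ.source)
    (hev : ∀ᶠ x in 𝓝 q, n x = I (!₂[(φ x).1, (φ x).2 ^ 3 + (φ x).1 * (φ x).2]))
    (hI : ContDiffAt ℝ ∞ I (!₂[(φ q).1, (φ q).2 ^ 3 + (φ q).1 * (φ q).2]))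
    (hIi : Function.Injective (fderiv ℝ I (!₂[(φ q).1, (φ q).2 ^ 3 + (φ q).1 * (φ q).2])))
    (hn : DifferentiableAt ℝ n q) (hY : Y ≠ 0) (h0 : fderiv ℝ n q Y = 0) :
    (φ q).1 = -3 * (φ q).2 ^ 2 := by
  have hφ := partialDiffeo_contDiffAt φ hq
  set k : ℝ → ℝ × ℝ := fun s => φ (q + s • Y) with hk
  have hkc : ContDiffAt ℝ ∞ k 0 := contDiffAt_line hφ Y
  have hkd : HasDerivAt k (fderiv ℝ φ q Y) 0 := hasDerivAt_line (hφ.differentiableAt (by simp)) Y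
  have hk0 : k 0 = φ q := by simp [hk]
  have hA : HasDerivAt (fun s => (k s).1) _ 0 := hasDerivAt_fst hkd
  have hB : HasDerivAt (fun s => (k s).2) _ 0 := hasDerivAt_snd hkd
  set w : ℝ → EuclideanSpace ℝ (Fin 2) := fun s => !₂[(k s).1, (k s).2 ^ 3 + (k s).1 * (k s).2]
    with hw
  have hwc : ContDiffAt ℝ ∞ w 0 := by
    rw [contDiffAt_euclidean]
    intro i
    fin_cases i
    · exact hkc.fst
    · exact (hkc.snd.pow 3).add (hkc.fst.mul hkc.snd)
  have hw0 : w 0 = !₂[(φ q).1, (φ q).2 ^ 3 + (φ q).1 * (φ q).2] := by simp only [hw, hk0]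
  have heq : (fun s : ℝ => n (q + s • Y)) =ᶠ[𝓝 0] fun s => I (w s) :=
    (tendsto_line q Y).eventually hev
  have hIw : deriv (fun s => I (w s)) 0 = fderiv ℝ I (w 0) (deriv w 0) :=
    deriv_comp_eq (by rw [hw0]; exact hI) hwc
  have hdw : deriv w 0 = 0 := by
    rw [← hw0] at hIi
    refine hIi ?_
    rw [← hIw, ← heq.deriv_eq, (hasDerivAt_line hn Y).deriv, h0, map_zero]
  have e0 : (fderiv ℝ φ q Y).1 = 0 := by
    have h1 := deriv_euclidean_apply hwc 0
    rw [hdw] at h1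
    exact hA.deriv.symm.trans h1.symm
  have e1 := deriv_euclidean_apply hwc 1
  rw [hdw] at e1
  have e2 := e1.trans ((hB.pow 3).add (hA.mul hB)).deriv
  rw [hk0, e0] at e2
  have hne : (fderiv ℝ φ q Y).2 ≠ 0 := by
    intro h1
    exact hY (fderiv_partialDiffeo_injective φ hq ((Prod.ext e0 h1).trans (map_zero _).symm))
  have e3 : (fderiv ℝ φ q Y).2 * (3 * (φ q).2 ^ 2 + (φ q).1) = 0 := by
    have : (0 : ℝ) = _ := e2
    simp at this
    linarith
  have := (mul_eq_zero.1 e3).resolve_left hne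
  linarith

/-! ### Cuspidal edges -/

/-- For a cuspidal edge `g ∘ X` with null direction `∂_v` at the origin, the vectors `g_u` and
`g_vv` are linearly independent. -/
lemma IsCuspidalEdge.cross_ne_zero {f : ℝ × ℝ → E3} {p : ℝ × ℝ} (h : IsCuspidalEdge f p)
    {X : PartialDiffeomorph 𝓘(ℝ, ℝ × ℝ) 𝓘(ℝ, ℝ × ℝ) (ℝ × ℝ) (ℝ × ℝ) ∞}
    (hX : (0 : ℝ × ℝ) ∈ X.source) (hX0 : X 0 = p)
    (hnull : pv (fun q => f (X q)) (0, 0) = 0) :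
    cross (pu (fun q => f (X q)) (0, 0)) (pv (pv fun q => f (X q)) (0, 0)) ≠ 0 := by
  obtain ⟨φ, I, hp, hp0, hev⟩ := AEquivalentAt.exists_immersion_E3 h
  have hXc := partialDiffeo_contDiffAt X hX
  have hφc := partialDiffeo_contDiffAt φ hp
  set Q : ℝ × ℝ → ℝ × ℝ := fun q => φ (X q) with hQ
  have hQ0 : Q 0 = 0 := by simp only [hQ, hX0, hp0]
  have hQc : ContDiffAt ℝ ∞ Q 0 := by
    rw [← hX0] at hφc
    exact hφc.comp 0 hXc
  have hQd : fderiv ℝ Q 0 = (fderiv ℝ φ p).comp (fderiv ℝ X 0) := by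
    rw [← hX0] at hφc ⊢
    exact fderiv_comp 0 (hφc.differentiableAt (by simp)) (hXc.differentiableAt (by simp))
  have hQi : Function.Injective (fderiv ℝ Q 0) := by
    rw [hQd]
    exact (fderiv_partialDiffeo_injective φ hp).comp (fderiv_partialDiffeo_injective X hX)
  have hXt : Tendsto X (𝓝 0) (𝓝 p) := hX0 ▸ hXc.continuousAt
  obtain ⟨-, -, hI, hIi⟩ := hev.self_of_nhds
  -- the restrictions of the normal form to a line through the origin
  have hline : ∀ Y : ℝ × ℝ, ∃ w : ℝ → E3, ContDiffAt ℝ ∞ w 0 ∧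
      (fun s : ℝ => f (X (s • Y))) =ᶠ[𝓝 0] (fun s => I (w s)) ∧
      w 0 = !₂[(φ p).1, (φ p).2 ^ 2, (φ p).2 ^ 3] ∧ deriv w 0 = !₂[(fderiv ℝ Q 0 Y).1, 0, 0] ∧
      (deriv w 0 = 0 → deriv (deriv w) 0 1 = 2 * (fderiv ℝ Q 0 Y).2 ^ 2) := by
    intro Y
    set k : ℝ → ℝ × ℝ := fun s => Q (0 + s • Y) with hk
    have hkc : ContDiffAt ℝ ∞ k 0 := contDiffAt_line hQc Y
    have hkd : HasDerivAt k (fderiv ℝ Q 0 Y) 0 :=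
      hasDerivAt_line (hQc.differentiableAt (by simp)) Y
    have hk0 : k 0 = 0 := by simp [hk, hQ0]
    have hA : HasDerivAt (fun s => (k s).1) _ 0 := hasDerivAt_fst hkd
    have hB : HasDerivAt (fun s => (k s).2) _ 0 := hasDerivAt_snd hkd
    have hwc : ContDiffAt ℝ ∞ (fun s => (!₂[(k s).1, (k s).2 ^ 2, (k s).2 ^ 3] : E3)) 0 := by
      rw [contDiffAt_euclidean]
      intro i
      fin_cases i
      · exact hkc.fst
      · exact hkc.snd.pow 2
      · exact hkc.snd.pow 3
    refine ⟨fun s => !₂[(k s).1, (k s).2 ^ 2, (k s).2 ^ 3], hwc, ?_, ?_, ?_, ?_⟩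
    · have h1 : Tendsto (fun s : ℝ => X (0 + s • Y)) (𝓝 0) (𝓝 p) :=
        hXt.comp (tendsto_line 0 Y)
      filter_upwards [h1.eventually hev] with s hs
      have h2 := hs.2.1
      simpa [hk, hQ] using h2
    · simp [hk0, hp0]
    · ext i
      rw [deriv_euclidean_apply hwc]
      fin_cases i
      · exact hA.deriv
      · exact (hB.pow 2).deriv.trans (by simp [hk0])
      · exact (hB.pow 3).deriv.trans (by simp [hk0])
    · intro h0
      rw [deriv_deriv_euclidean_apply hwc h0]
      exact (deriv_deriv_sq hkc.snd (by simp [hk0])).trans (by rw [hB.deriv])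
  obtain ⟨w, hwc, hwe, hw0, hw1, hw2⟩ := hline (0, 1)
  obtain ⟨w', hwc', hwe', hw0', hw1', -⟩ := hline (1, 0)
  simp only [Prod.smul_mk, smul_eq_mul, mul_zero, mul_one] at hwe hwe'
  have hIw : ContDiffAt ℝ ∞ I (w 0) := by rw [hw0]; exact hI
  have hdw : deriv w 0 = 0 := by
    refine hIi ?_
    have h1 := deriv_comp_eq hIw hwc
    rw [← hwe.deriv_eq, hw0] at h1
    rw [← h1, map_zero]
    exact hnull
  have hvv : pv (pv fun q => f (X q)) (0, 0) =
      fderiv ℝ I (!₂[(φ p).1, (φ p).2 ^ 2, (φ p).2 ^ 3]) (deriv (deriv w) 0) := by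
    rw [← hw0, ← deriv_deriv_comp_of_deriv_eq_zero hIw hwc hdw, ← hwe.deriv.deriv_eq]
    rfl
  have hu : pu (fun q => f (X q)) (0, 0) =
      fderiv ℝ I (!₂[(φ p).1, (φ p).2 ^ 2, (φ p).2 ^ 3]) (deriv w' 0) := by
    rw [← hw0', ← deriv_comp_eq (by rw [hw0']; exact hI) hwc', ← hwe'.deriv_eq]
    rfl
  have hA0 : (fderiv ℝ Q 0 (0, 1)).1 = 0 := by
    rw [hdw] at hw1
    have := congrArg (fun v : E3 => v 0) hw1
    simpa using this.symm
  have hB0 : (fderiv ℝ Q 0 (0, 1)).2 ≠ 0 := by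
    intro h1
    have := hQi ((Prod.ext hA0 h1 : fderiv ℝ Q 0 (0, 1) = 0).trans (map_zero _).symm)
    simp at this
  have hA1 : (fderiv ℝ Q 0 (1, 0)).1 ≠ 0 := by
    intro h1
    have h2 : fderiv ℝ Q 0 ((fderiv ℝ Q 0 (0, 1)).2 • ((1, 0) : ℝ × ℝ)
        - (fderiv ℝ Q 0 (1, 0)).2 • ((0, 1) : ℝ × ℝ)) = 0 := by
      rw [map_sub, map_smul, map_smul]
      apply Prod.ext
      · simp [h1, hA0]
      · simp [mul_comm]
    have h3 := hQi (h2.trans (map_zero _).symm)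
    have h4 := congrArg Prod.fst h3
    simp at h4
    exact hB0 h4
  rw [hu, hvv]
  refine FrontSurface.cross_ne_zero fun x y hxy => ?_
  rw [← map_smul, ← map_smul, ← map_add] at hxy
  have h1 := hIi (hxy.trans (map_zero _).symm)
  have h2 := congrArg (fun v : E3 => v 1) h1
  have h3 := congrArg (fun v : E3 => v 0) h1
  have hy : y = 0 := by
    simp only [PiLp.add_apply, PiLp.smul_apply, hw1', hw2 hdw] at h2
    simpa [hB0] using h2
  refine ⟨?_, hy⟩
  rw [hy] at h3
  simp only [PiLp.add_apply, PiLp.smul_apply, hw1'] at h3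
  simpa [hA1] using h3

/-! ### Singular points and existence of adapted coordinates -/

lemma mem_singularSet_iff {f : ℝ × ℝ → E3} {D : Set (ℝ × ℝ)} {q : ℝ × ℝ} :
    q ∈ singularSet f D ↔ q ∈ D ∧ ∃ Y : ℝ × ℝ, Y ≠ 0 ∧ fderiv ℝ f q Y = 0 := by
  have h := LinearMap.finrank_range_add_finrank_ker (fderiv ℝ f q).toLinearMap
  rw [Module.finrank_prod, Module.finrank_self] at h
  have hk : Module.finrank ℝ (LinearMap.ker (fderiv ℝ f q).toLinearMap) ≠ 0 ↔
      ∃ Y : ℝ × ℝ, Y ≠ 0 ∧ fderiv ℝ f q Y = 0 := by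
    rw [Ne, Submodule.finrank_eq_zero, ← Ne, Submodule.ne_bot_iff]
    exact ⟨fun ⟨Y, h1, h2⟩ => ⟨Y, h2, h1⟩, fun ⟨Y, h1, h2⟩ => ⟨Y, h2, h1⟩⟩
  rw [singularSet, mem_ofPred_eq, ← hk]
  refine and_congr_right fun _ => ?_
  omega

lemma det_ne_zero_of_injective {L : ℝ × ℝ →L[ℝ] ℝ × ℝ} (h : Function.Injective L) : L.det ≠ 0 := by
  intro h0
  have h1 := LinearMap.bot_lt_ker_of_det_eq_zero h0
  rw [LinearMap.ker_eq_bot.2 h] at h1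
  exact lt_irrefl _ h1

/-- The linear map `(u, v) ↦ (u, e v)`, for `e = ± 1`, as a partial diffeomorphism. -/
noncomputable def reflection (e : ℝ) (he : e * e = 1) :
    PartialDiffeomorph 𝓘(ℝ, ℝ × ℝ) 𝓘(ℝ, ℝ × ℝ) (ℝ × ℝ) (ℝ × ℝ) ∞ where
  toFun q := (q.1, e * q.2)
  invFun q := (q.1, e * q.2)
  source := univ
  target := univ
  map_source' _ _ := mem_univ _
  map_target' _ _ := mem_univ _
  left_inv' q _ := by simp [← mul_assoc, he]
  right_inv' q _ := by simp [← mul_assoc, he]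
  open_source := isOpen_univ
  open_target := isOpen_univ
  contMDiffOn_toFun := contMDiffOn_iff_contDiffOn.2
    (contDiff_fst.prodMk (contDiff_const.mul contDiff_snd)).contDiffOn
  contMDiffOn_invFun := contMDiffOn_iff_contDiffOn.2
    (contDiff_fst.prodMk (contDiff_const.mul contDiff_snd)).contDiffOn

/-- The differential of a cuspidal edge in coordinates `X` which, up to the sign `e`, are those of
its normal form. -/
lemma fderiv_apply_eq_zero_iff_of_normal_form {f : ℝ × ℝ → E3} {I : E3 → E3}
    {X : ℝ × ℝ → ℝ × ℝ} {q : ℝ × ℝ} {e : ℝ} (he : e * e = 1)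
    (hX : DifferentiableAt ℝ X q) (hf : DifferentiableAt ℝ f (X q))
    (hev : ∀ᶠ x in 𝓝 q, f (X x) = I (!₂[x.1, (e * x.2) ^ 2, (e * x.2) ^ 3]))
    (hI : ContDiffAt ℝ ∞ I (!₂[q.1, (e * q.2) ^ 2, (e * q.2) ^ 3]))
    (hIi : Function.Injective (fderiv ℝ I (!₂[q.1, (e * q.2) ^ 2, (e * q.2) ^ 3])))
    (Y : ℝ × ℝ) : fderiv ℝ f (X q) (fderiv ℝ X q Y) = 0 ↔ Y.1 = 0 ∧ q.2 * Y.2 = 0 := by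
  have he0 : e ≠ 0 := by rintro rfl; simp at he
  set k : ℝ → ℝ × ℝ := fun s => q + s • Y with hk
  have hkd : HasDerivAt k Y 0 := by
    have h := ((hasDerivAt_id (0 : ℝ)).smul_const Y).const_add q
    rw [one_smul] at h
    exact h
  have hkc : ContDiffAt ℝ ∞ k 0 := contDiffAt_line (h := fun x : ℝ × ℝ => x) contDiffAt_id Y
  have hk0 : k 0 = q := by simp [hk]
  have hA : HasDerivAt (fun s => (k s).1) _ 0 := hasDerivAt_fst hkd
  have hB : HasDerivAt (fun s => (k s).2) _ 0 := hasDerivAt_snd hkd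
  set w : ℝ → E3 := fun s => !₂[(k s).1, (e * (k s).2) ^ 2, (e * (k s).2) ^ 3] with hw
  have hwc : ContDiffAt ℝ ∞ w 0 := by
    rw [contDiffAt_euclidean]
    intro i
    fin_cases i
    · exact hkc.fst
    · exact (contDiffAt_const.mul hkc.snd).pow 2
    · exact (contDiffAt_const.mul hkc.snd).pow 3
  have hw0 : w 0 = !₂[q.1, (e * q.2) ^ 2, (e * q.2) ^ 3] := by simp only [hw, hk0]
  have hdw : deriv w 0 = !₂[Y.1, 2 * (e * q.2) * (e * Y.2), 3 * (e * q.2) ^ 2 * (e * Y.2)] := by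
    ext i
    rw [deriv_euclidean_apply hwc]
    fin_cases i
    · exact hA.deriv
    · exact ((hB.const_mul e).pow 2).deriv.trans (by simp [hk0])
    · exact ((hB.const_mul e).pow 3).deriv.trans (by simp [hk0])
  have h1 : fderiv ℝ f (X q) (fderiv ℝ X q Y) = fderiv ℝ I (w 0) (deriv w 0) := by
    rw [← deriv_comp_eq (by rw [hw0]; exact hI) hwc]
    have h2 : (fun s : ℝ => f (X (q + s • Y))) =ᶠ[𝓝 0] fun s => I (w s) :=
      (tendsto_line q Y).eventually hev
    rw [← h2.deriv_eq]
    have h3 := hasDerivAt_line (h := fun x => f (X x)) (hf.comp q hX) Y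
    rw [h3.deriv, show fderiv ℝ (fun x => f (X x)) q = _ from fderiv_comp q hf hX]
    rfl
  rw [h1, ← map_zero (fderiv ℝ I (w 0)), hw0, hIi.eq_iff, hdw]
  constructor
  · intro h
    have h2 := congrArg (fun v : E3 => v 0) h
    have h3 := congrArg (fun v : E3 => v 1) h
    refine ⟨by simpa using h2, ?_⟩
    have h4 : 2 * (e * q.2) * (e * Y.2) = 0 := by simpa using h3
    linear_combination h4 / 2 - q.2 * Y.2 * he
  · rintro ⟨h2, h3⟩
    apply E3_ext
    · simpa using h2
    · change 2 * (e * q.2) * (e * Y.2) = 0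
      linear_combination 2 * e * e * h3
    · change 3 * (e * q.2) ^ 2 * (e * Y.2) = 0
      linear_combination 3 * e ^ 3 * q.2 * h3

lemma IsCuspidalEdge.exists_isAdapted {f : ℝ × ℝ → E3} {p : ℝ × ℝ} (h : IsCuspidalEdge f p)
    {D : Set (ℝ × ℝ)} (hD : IsOpen D) (hpD : p ∈ D) (hf : ContDiffOn ℝ ∞ f D) :
    ∃ X, IsAdapted X f D p := by
  obtain ⟨φ, I, hp, hp0, hev⟩ := AEquivalentAt.exists_immersion_E3 h
  have h0t : (0 : ℝ × ℝ) ∈ φ.target := hp0 ▸ partialDiffeo_map_mem φ hp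
  have hs0 : φ.symm 0 = p := by rw [← hp0]; exact partialDiffeo_left_inv φ hp
  have hdet : (fderiv ℝ φ.symm 0).det ≠ 0 :=
    det_ne_zero_of_injective (fderiv_partialDiffeo_injective φ.symm h0t)
  -- reflect the coordinates of the normal form if they reverse the orientation
  obtain ⟨e, he, hpos⟩ : ∃ e : ℝ, e * e = 1 ∧ 0 < e * (fderiv ℝ φ.symm 0).det := by
    rcases lt_or_gt_of_ne hdet with h1 | h1
    · exact ⟨-1, by norm_num, by linarith⟩
    · exact ⟨1, by norm_num, by linarith⟩
  set X₀ := (reflection e he).trans φ.symm with hX₀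
  have hcoe : ∀ q, X₀ q = φ.symm (q.1, e * q.2) := fun q => rfl
  have hsrc : ∀ q, q ∈ X₀.source → (q.1, e * q.2) ∈ φ.target := fun q hq => hq.2
  have h0s : (0 : ℝ × ℝ) ∈ X₀.source := ⟨mem_univ _, by
    change ((0 : ℝ), e * (0 : ℝ)) ∈ φ.target
    rw [mul_zero]
    exact h0t⟩
  have hX₀0 : X₀ 0 = p := by
    change φ.symm ((0 : ℝ), e * (0 : ℝ)) = p
    rw [mul_zero]
    exact hs0
  have hc0 := partialDiffeo_contDiffAt X₀ h0s
  have hdet0 : 0 < (fderiv ℝ X₀ 0).det := by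
    have h1 : ∀ Y : ℝ × ℝ, fderiv ℝ X₀ 0 Y = fderiv ℝ φ.symm 0 (Y.1, e * Y.2) := by
      intro Y
      have h2 := (hasDerivAt_line (hc0.differentiableAt (by simp)) Y).deriv
      have h3 := (hasDerivAt_line ((partialDiffeo_symm_contDiffAt φ h0t).differentiableAt
        (by simp)) (Y.1, e * Y.2)).deriv
      rw [← h2, ← h3]
      congr 1
      ext1 s
      rw [hcoe]
      congr 1
      ext <;> simp
      ring
    rw [det_eq_entries] at hpos ⊢
    rw [h1, h1]
    have h4 : ((0 : ℝ), e * (1 : ℝ)) = e • ((0, 1) : ℝ × ℝ) := by simp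
    simp only [mul_zero, h4, map_smul, Prod.smul_fst, Prod.smul_snd, smul_eq_mul]
    linarith
  have hE1 : ∀ᶠ q in 𝓝 (0 : ℝ × ℝ), 0 < (fderiv ℝ X₀ q).det := by
    simp only [det_eq_entries] at hdet0 ⊢
    have hc : ContinuousAt (fderiv ℝ X₀) 0 :=
      (hc0.fderiv_right (m := ∞) (by simp)).continuousAt
    have ha : ContinuousAt (fun q => fderiv ℝ X₀ q (1, 0)) 0 := hc.clm_apply continuousAt_const
    have hb : ContinuousAt (fun q => fderiv ℝ X₀ q (0, 1)) 0 := hc.clm_apply continuousAt_const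
    exact (((ha.fst).mul (hb.snd)).sub ((hb.fst).mul (ha.snd))).eventually
      (lt_mem_nhds hdet0)
  have ht : Tendsto X₀ (𝓝 0) (𝓝 p) := hX₀0 ▸ hc0.continuousAt
  obtain ⟨O, hO, hOo, h0O⟩ := eventually_nhds_iff.1
    (hE1.and ((ht.eventually (hD.mem_nhds hpD)).and (ht.eventually hev.eventually_nhds)))
  set X := restrictOpen X₀ O hOo with hX
  have hXX : ∀ q, X q = X₀ q := fun q => rfl
  have hφX : ∀ q ∈ X.source, φ (X q) = (q.1, e * q.2) := fun q hq =>
    partialDiffeo_right_inv φ (hsrc q hq.1)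
  have key : ∀ q ∈ X.source, ∀ Y : ℝ × ℝ,
      fderiv ℝ f (X q) (fderiv ℝ X q Y) = 0 ↔ Y.1 = 0 ∧ q.2 * Y.2 = 0 := by
    intro q hq Y
    have hXq := partialDiffeo_contDiffAt X hq
    have hev' : ∀ᶠ x in 𝓝 (X q), _ := (hO q hq.2).2.2
    have hs := hev'.self_of_nhds
    rw [hφX q hq] at hs
    refine fderiv_apply_eq_zero_iff_of_normal_form (I := I) he (hXq.differentiableAt (by simp))
      ((hf.contDiffAt (hD.mem_nhds (hO q hq.2).2.1)).differentiableAt (by simp)) ?_ hs.2.2.1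
      hs.2.2.2 Y
    filter_upwards [hXq.continuousAt.eventually hev', X.open_source.mem_nhds hq] with x hx hxs
    rw [hx.2.1, hφX x hxs]
  refine ⟨X, ⟨h0s, h0O⟩, hX₀0, ?_, ?_, ?_, ?_⟩
  · intro y hy
    have := hO _ (X.map_target hy).2
    have h2 : X₀ (X.symm y) = y := X.right_inv hy
    exact h2 ▸ this.2.1
  · intro q hq
    exact (hO q hq.2).1
  · intro q hq
    rw [mem_singularSet_iff]
    constructor
    · rintro ⟨-, Z, hZ, hZ0⟩
      by_contra hne
      have h1 := fderiv_apply_fderiv_symm X hq Z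
      rw [← h1, key q hq] at hZ0
      refine hZ ?_
      rw [← h1, show fderiv ℝ X.symm (X q) Z = 0 from
        Prod.ext hZ0.1 ((mul_eq_zero.1 hZ0.2).resolve_left hne), map_zero]
    · intro h2
      refine ⟨(hO q hq.2).2.1, fderiv ℝ X q (0, 1), ?_, (key q hq _).2 (by simp [h2])⟩
      intro h3
      have := fderiv_partialDiffeo_injective X hq (h3.trans (map_zero _).symm)
      simp at this
  · intro u hu
    have hd1 := (partialDiffeo_contDiffAt X hu).differentiableAt (by simp)
    have hd2 := (hf.contDiffAt (hD.mem_nhds (hO _ hu.2).2.1)).differentiableAt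
      (by simp : (∞ : WithTop ℕ∞) ≠ 0)
    have hd3 : DifferentiableAt ℝ (fun q => f (X q)) (u, 0) := hd2.comp (u, (0 : ℝ)) hd1
    rw [pv_eq hd3, show fderiv ℝ (fun q => f (X q)) (u, 0) = _ from
      fderiv_comp (u, (0 : ℝ)) hd2 hd1]
    exact (key _ hu _).2 (by simp)

/-! ### Fronts, their pull-backs and their Gaussian curvature -/

section Front

variable {f : ℝ × ℝ → E3} {ν : ℝ × ℝ → S2} {D : Set (ℝ × ℝ)} {q : ℝ × ℝ}

lemma norm_coe_S2 (x : S2) : ‖(x : E3)‖ = 1 := by simp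

lemma IsFront.contDiffAt (h : IsFront f ν D) (hD : IsOpen D) (hq : q ∈ D) : ContDiffAt ℝ ∞ f q :=
  h.smooth.contDiffAt (hD.mem_nhds hq)

lemma IsFront.contDiffAt_gauss (h : IsFront f ν D) (hD : IsOpen D) (hq : q ∈ D) :
    ContDiffAt ℝ ∞ (fun x => (ν x : E3)) q :=
  h.smooth_gauss.contDiffAt (hD.mem_nhds hq)

/-- A reparametrization of a front is a front. -/
lemma IsFront.comp (h : IsFront f ν D) (hD : IsOpen D)
    (X : PartialDiffeomorph 𝓘(ℝ, ℝ × ℝ) 𝓘(ℝ, ℝ × ℝ) (ℝ × ℝ) (ℝ × ℝ) ∞) (hX : X.target ⊆ D) :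
    IsFront (fun q => f (X q)) (fun q => ν (X q)) X.source := by
  have hm : ∀ q ∈ X.source, X q ∈ D := fun q hq => hX (partialDiffeo_map_mem X hq)
  have hXd : ∀ q ∈ X.source, DifferentiableAt ℝ X q := fun q hq =>
    (partialDiffeo_contDiffAt X hq).differentiableAt (by simp)
  refine ⟨?_, ?_, ?_, ?_⟩
  · exact fun q hq => ((h.contDiffAt hD (hm q hq)).comp q
      (partialDiffeo_contDiffAt X hq)).contDiffWithinAt
  · exact fun q hq => ((h.contDiffAt_gauss hD (hm q hq)).comp q
      (partialDiffeo_contDiffAt X hq)).contDiffWithinAt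
  · intro q hq Y
    rw [show fderiv ℝ (fun q => f (X q)) q = _ from
      fderiv_comp q ((h.contDiffAt hD (hm q hq)).differentiableAt (by simp)) (hXd q hq)]
    exact h.orthogonal _ (hm q hq) _
  · intro q hq
    have hd : DifferentiableAt ℝ (fun x => (f x, (ν x : E3))) (X q) :=
      ((h.contDiffAt hD (hm q hq)).differentiableAt (by simp)).prodMk
        ((h.contDiffAt_gauss hD (hm q hq)).differentiableAt (by simp))
    rw [show fderiv ℝ (fun x => (f (X x), (ν (X x) : E3))) q = _ from
      fderiv_comp q hd (hXd q hq)]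
    exact (h.immersive _ (hm q hq)).comp (fderiv_partialDiffeo_injective X hq)

/-- Change of variables for the area densities `det(k_u, k_v, n)`. -/
lemma det3_partials_comp {k : ℝ × ℝ → E3} {X : ℝ × ℝ → ℝ × ℝ} (hX : DifferentiableAt ℝ X q)
    (hk : DifferentiableAt ℝ k (X q)) (n : E3) :
    det3 (pu (fun x => k (X x)) q) (pv (fun x => k (X x)) q) n =
      (fderiv ℝ X q).det * det3 (pu k (X q)) (pv k (X q)) n := by
  have hd : DifferentiableAt ℝ (fun x => k (X x)) q := hk.comp q hX
  have h1 : ∀ Y, fderiv ℝ (fun x => k (X x)) q Y =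
      (fderiv ℝ X q Y).1 • pu k (X q) + (fderiv ℝ X q Y).2 • pv k (X q) := by
    intro Y
    rw [← fderiv_eq_partials hk, show fderiv ℝ (fun x => k (X x)) q = _ from fderiv_comp q hk hX]
    rfl
  rw [pu_eq hd, pv_eq hd, h1, h1, det3_combination, det_eq_entries]

lemma IsFront.inner_pu (h : IsFront f ν D) (hD : IsOpen D) (hq : q ∈ D) :
    ⟪pu f q, (ν q : E3)⟫ = 0 := by
  rw [pu_eq ((h.contDiffAt hD hq).differentiableAt (by simp))]
  exact h.orthogonal q hq _

lemma IsFront.inner_pv (h : IsFront f ν D) (hD : IsOpen D) (hq : q ∈ D) :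
    ⟪pv f q, (ν q : E3)⟫ = 0 := by
  rw [pv_eq ((h.contDiffAt hD hq).differentiableAt (by simp))]
  exact h.orthogonal q hq _

lemma tendsto_mk_left (q : ℝ × ℝ) : Tendsto (fun s : ℝ => (s, q.2)) (𝓝 q.1) (𝓝 q) := by
  have : Continuous (fun s : ℝ => (s, q.2)) := by fun_prop
  simpa using this.tendsto q.1

lemma tendsto_mk_right (q : ℝ × ℝ) : Tendsto (fun s : ℝ => (q.1, s)) (𝓝 q.2) (𝓝 q) := by
  have : Continuous (fun s : ℝ => (q.1, s)) := by fun_prop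
  simpa using this.tendsto q.2

lemma inner_pu_add {a b : ℝ × ℝ → E3} (ha : ContDiffAt ℝ ∞ a q) (hb : ContDiffAt ℝ ∞ b q)
    (h : ∀ᶠ x in 𝓝 q, ⟪a x, b x⟫ = 0) : ⟪a q, pu b q⟫ + ⟪pu a q, b q⟫ = 0 :=
  inner_deriv_add (a := fun s => a (s, q.2)) (b := fun s => b (s, q.2)) (u := q.1)
    (hasDerivAt_pu (ha.differentiableAt (by simp))).differentiableAt
    (hasDerivAt_pu (hb.differentiableAt (by simp))).differentiableAt
    ((tendsto_mk_left q).eventually h)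

lemma inner_pv_add {a b : ℝ × ℝ → E3} (ha : ContDiffAt ℝ ∞ a q) (hb : ContDiffAt ℝ ∞ b q)
    (h : ∀ᶠ x in 𝓝 q, ⟪a x, b x⟫ = 0) : ⟪a q, pv b q⟫ + ⟪pv a q, b q⟫ = 0 :=
  inner_deriv_add (a := fun s => a (q.1, s)) (b := fun s => b (q.1, s)) (u := q.2)
    (hasDerivAt_pv (ha.differentiableAt (by simp))).differentiableAt
    (hasDerivAt_pv (hb.differentiableAt (by simp))).differentiableAt
    ((tendsto_mk_right q).eventually h)

lemma IsFront.inner_pu_gauss (h : IsFront f ν D) (hD : IsOpen D) (hq : q ∈ D) :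
    ⟪pu (fun x => (ν x : E3)) q, (ν q : E3)⟫ = 0 :=
  deriv_inner_self_of_unit (N := fun s => (ν (s, q.2) : E3)) (u := q.1)
    (hasDerivAt_pu ((h.contDiffAt_gauss hD hq).differentiableAt (by simp))).differentiableAt
    (Eventually.of_forall fun _ => norm_coe_S2 _)

lemma IsFront.inner_pv_gauss (h : IsFront f ν D) (hD : IsOpen D) (hq : q ∈ D) :
    ⟪pv (fun x => (ν x : E3)) q, (ν q : E3)⟫ = 0 :=
  deriv_inner_self_of_unit (N := fun s => (ν (q.1, s) : E3)) (u := q.2)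
    (hasDerivAt_pv ((h.contDiffAt_gauss hD hq).differentiableAt (by simp))).differentiableAt
    (Eventually.of_forall fun _ => norm_coe_S2 _)

lemma IsFront.inner_pu_pv_gauss (h : IsFront f ν D) (hD : IsOpen D) (hq : q ∈ D) :
    ⟪pu f q, pv (fun x => (ν x : E3)) q⟫ = -⟪pv (pu f) q, (ν q : E3)⟫ := by
  have h1 := inner_pv_add (contDiffAt_pu (h.contDiffAt hD hq)) (h.contDiffAt_gauss hD hq)
    (by filter_upwards [hD.mem_nhds hq] with x hx using h.inner_pu hD hx)
  linarith

lemma IsFront.inner_pv_pu_gauss (h : IsFront f ν D) (hD : IsOpen D) (hq : q ∈ D) :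
    ⟪pv f q, pu (fun x => (ν x : E3)) q⟫ = -⟪pv (pu f) q, (ν q : E3)⟫ := by
  have h1 := inner_pu_add (contDiffAt_pv (h.contDiffAt hD hq)) (h.contDiffAt_gauss hD hq)
    (by filter_upwards [hD.mem_nhds hq] with x hx using h.inner_pv hD hx)
  rw [pv_pu_eq_pu_pv (h.contDiffAt hD hq)]
  linarith

lemma IsFront.inner_pv_pv (h : IsFront f ν D) (hD : IsOpen D) (hq : q ∈ D)
    (hnull : pv f q = 0) : ⟪pv (pv f) q, (ν q : E3)⟫ = 0 := by
  have h1 := inner_pv_add (contDiffAt_pv (h.contDiffAt hD hq)) (h.contDiffAt_gauss hD hq)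
    (by filter_upwards [hD.mem_nhds hq] with x hx using h.inner_pv hD hx)
  rw [hnull, inner_zero_left, zero_add] at h1
  exact h1

lemma inner_cross_cross (a b c d : E3) :
    ⟪cross a b, cross c d⟫ = ⟪a, c⟫ * ⟪b, d⟫ - ⟪a, d⟫ * ⟪b, c⟫ := by
  simp only [inner_E3, cross_apply_zero, cross_apply_one, cross_apply_two]; ring

/-- The Gaussian curvature is the quotient `Λ / λ`. -/
lemma IsFront.gaussianCurvature_eq (h : IsFront f ν D) (hD : IsOpen D) (hq : q ∈ D) :
    gaussianCurvature f ν q = signedAreaDensity f ν q * discriminant ν q /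
      signedAreaDensity f ν q ^ 2 := by
  have hn := norm_coe_S2 (ν q)
  have h1 := cross_eq_smul (h.inner_pu hD hq) (h.inner_pv hD hq) hn
  have h2 := cross_eq_smul (h.inner_pu_gauss hD hq) (h.inner_pv_gauss hD hq) hn
  have h3 := inner_cross_cross (pu f q) (pv f q) (pu (fun x => (ν x : E3)) q)
    (pv (fun x => (ν x : E3)) q)
  rw [h1, h2, inner_smul_left, inner_smul_right, real_inner_self_eq_norm_sq, hn] at h3
  have h4 := norm_cross_sq (pu f q) (pv f q)
  rw [h1, norm_smul, hn, mul_one, Real.norm_eq_abs, sq_abs] at h4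
  rw [h.inner_pv_pu_gauss hD hq, ← h.inner_pu_pv_gauss hD hq] at h3
  simp only [conj_trivial] at h3
  simp only [gaussianCurvature, signedAreaDensity, discriminant]
  rw [h4]
  congr 1
  · linear_combination -h3
  · rw [real_inner_self_eq_norm_sq, real_inner_self_eq_norm_sq]

lemma signedAreaDensity_eq_zero_of_singular (h : IsFront f ν D) (hD : IsOpen D)
    (hq : q ∈ singularSet f D) : signedAreaDensity f ν q = 0 := by
  obtain ⟨hqD, Y, hY, hY0⟩ := mem_singularSet_iff.1 hq
  rw [← Prod.mk.eta (p := Y),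
    fderiv_eq_partials ((h.contDiffAt hD hqD).differentiableAt (by simp))] at hY0
  have h1 : Y.1 * signedAreaDensity f ν q = det3 (Y.1 • pu f q + Y.2 • pv f q) (pv f q) (ν q) := by
    simp only [signedAreaDensity, det3_eq, PiLp.add_apply, PiLp.smul_apply, smul_eq_mul]; ring
  have h2 : Y.2 * signedAreaDensity f ν q = det3 (pu f q) (Y.1 • pu f q + Y.2 • pv f q) (ν q) := by
    simp only [signedAreaDensity, det3_eq, PiLp.add_apply, PiLp.smul_apply, smul_eq_mul]; ring
  rw [hY0] at h1 h2
  have h3 : Y.1 * signedAreaDensity f ν q = 0 := h1.trans (by simp [det3_eq])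
  have h4 : Y.2 * signedAreaDensity f ν q = 0 := h2.trans (by simp [det3_eq])
  by_contra hne
  exact hY (Prod.ext ((mul_eq_zero.1 h3).resolve_right hne) ((mul_eq_zero.1 h4).resolve_right hne))

lemma IsFront.contDiffAt_signedAreaDensity (h : IsFront f ν D) (hD : IsOpen D) (hq : q ∈ D) :
    ContDiffAt ℝ ∞ (signedAreaDensity f ν) q :=
  contDiffAt_det3 (contDiffAt_pu (h.contDiffAt hD hq)) (contDiffAt_pv (h.contDiffAt hD hq))
    (h.contDiffAt_gauss hD hq)

lemma IsFront.contDiffAt_discriminant (h : IsFront f ν D) (hD : IsOpen D) (hq : q ∈ D) :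
    ContDiffAt ℝ ∞ (discriminant ν) q :=
  contDiffAt_det3 (contDiffAt_pu (h.contDiffAt_gauss hD hq))
    (contDiffAt_pv (h.contDiffAt_gauss hD hq)) (h.contDiffAt_gauss hD hq)

/-- At a parabolic point the differential of the Gauss map is not injective. -/
lemma IsFront.exists_fderiv_gauss_eq_zero (h : IsFront f ν D) (hD : IsOpen D) (hq : q ∈ D)
    (h0 : discriminant ν q = 0) :
    ∃ Y : ℝ × ℝ, Y ≠ 0 ∧ fderiv ℝ (fun x => (ν x : E3)) q Y = 0 := by
  obtain ⟨x, y, hne, hxy⟩ := exists_combination_eq_zero (h.inner_pu_gauss hD hq)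
    (h.inner_pv_gauss hD hq) (norm_coe_S2 _) h0
  refine ⟨(x, y), ?_, ?_⟩
  · simpa [Prod.ext_iff, imp_iff_not_or] using hne
  · rw [fderiv_eq_partials ((h.contDiffAt_gauss hD hq).differentiableAt (by simp)), hxy]

/-- Where the Gaussian curvature is non-zero and bounded, the parabolic points are the singular
points: `Λ = K λ` off the singular set, which is the boundary of the region `λ > 0`. -/
lemma IsFront.discriminant_eq_zero_iff (h : IsFront f ν D) (hD : IsOpen D) {U : Set (ℝ × ℝ)}
    (hU : IsOpen U) (hUD : U ⊆ D) {p : ℝ × ℝ} {ε : ℝ} {γ : ℝ → ℝ × ℝ}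
    (hγ : IsSingularCurve γ ε f D U p) (hleft : PositiveOnLeft γ ε (signedAreaDensity f ν))
    (hK : ∀ q ∈ U, q ∉ singularSet f D → gaussianCurvature f ν q ≠ 0)
    (hKb : ∃ C : ℝ, ∀ q ∈ U, q ∉ singularSet f D → |gaussianCurvature f ν q| ≤ C) (hq : q ∈ U) :
    discriminant ν q = 0 ↔ q ∈ singularSet f D := by
  constructor
  · intro h0
    by_contra hs
    refine hK q hq hs ?_
    rw [h.gaussianCurvature_eq hD (hUD hq), h0]
    simp
  · intro hs
    obtain ⟨C, hC⟩ := hKb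
    have hqi : q ∈ γ '' Ioo (-ε) ε := by rw [hγ.image_eq]; exact ⟨hs, hq⟩
    obtain ⟨t, ht, rfl⟩ := hqi
    set J : ℝ × ℝ := (-(deriv γ t).2, (deriv γ t).1)
    have hlim : Tendsto (fun s : ℝ => γ t + s • J) (𝓝[>] 0) (𝓝 (γ t)) :=
      (tendsto_line (γ t) J).mono_left nhdsWithin_le_nhds
    have hΛ : Tendsto (fun s : ℝ => |discriminant ν (γ t + s • J)|) (𝓝[>] 0)
        (𝓝 |discriminant ν (γ t)|) :=
      ((h.contDiffAt_discriminant hD (hUD hq)).continuousAt.tendsto.comp hlim).abs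
    have hlam : Tendsto (fun s : ℝ => C * signedAreaDensity f ν (γ t + s • J)) (𝓝[>] 0)
        (𝓝 (C * signedAreaDensity f ν (γ t))) :=
      ((h.contDiffAt_signedAreaDensity hD (hUD hq)).continuousAt.tendsto.comp hlim).const_mul C
    have hle := le_of_tendsto_of_tendsto hΛ hlam (by
      filter_upwards [hleft t ht, hlim.eventually (hU.mem_nhds hq)] with s hs1 hs2
      have hns : γ t + s • J ∉ singularSet f D := fun hmem =>
        hs1.ne' (signedAreaDensity_eq_zero_of_singular h hD hmem)
      have hb := hC _ hs2 hns
      rw [h.gaussianCurvature_eq hD (hUD hs2), sq, mul_div_mul_left _ _ hs1.ne', abs_div,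
        abs_of_pos hs1, div_le_iff₀ hs1] at hb
      exact hb)
    rw [signedAreaDensity_eq_zero_of_singular h hD hs, mul_zero] at hle
    exact abs_eq_zero.1 (le_antisymm hle (abs_nonneg _))

lemma det3_cross_self (x n t : E3) :
    det3 x (cross n t) n = ‖n‖ ^ 2 * ⟪x, t⟫ - ⟪x, n⟫ * ⟪n, t⟫ := by
  simp only [det3_eq, norm_sq_E3, inner_E3, cross_apply_zero, cross_apply_one, cross_apply_two]
  ring

/-- Along an axis of singular points with null direction `∂_v`, which are also parabolic points,
the derivative of the Gauss map is orthogonal to the tangent of the axis. -/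
lemma IsFront.isSingularAxisFrame (h : IsFront f ν D) (hD : IsOpen D) {u : ℝ} (hu : (u, 0) ∈ D)
    (hnull : ∀ᶠ s in 𝓝 u, pv f (s, 0) = 0) (hdisc : discriminant ν (u, 0) = 0)
    (hcross : cross (pu f (u, 0)) (pv (pv f) (u, 0)) ≠ 0) :
    IsSingularAxisFrame (fun s => (ν (s, 0) : E3)) (fun s => pu f (s, 0))
      (fun s => pv (pv f) (s, 0)) u := by
  have hf := h.contDiffAt hD hu
  have hν := h.contDiffAt_gauss hD hu
  have hline : ContDiffAt ℝ ∞ (fun s : ℝ => (s, (0 : ℝ))) u :=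
    contDiffAt_id.prodMk contDiffAt_const
  have hn := norm_coe_S2 (ν (u, 0))
  have hnull0 : pv f (u, 0) = 0 := hnull.self_of_nhds
  have hTne : pu f (u, 0) ≠ 0 := by
    intro h0
    rw [h0] at hcross
    exact hcross (by apply E3_ext <;> simp [cross_apply_zero, cross_apply_one, cross_apply_two])
  refine ⟨ContDiffAt.comp (g := fun x => (ν x : E3)) u hν hline,
    ContDiffAt.comp (g := pu f) u (contDiffAt_pu hf) hline,
    ContDiffAt.comp (g := pv (pv f)) u (contDiffAt_pv (contDiffAt_pv hf)) hline,
    hn, h.inner_pu hD hu, ?_, ?_, hTne, hcross⟩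
  · exact h.inner_pv_pv hD hu hnull0
  · -- the derivative of the Gauss map in the null direction is a non-zero multiple of `N × T`
    set V := pv (fun x => (ν x : E3)) (u, 0) with hV
    have hVne : V ≠ 0 := by
      intro h0
      have hd1 := hf.differentiableAt (by simp : (∞ : WithTop ℕ∞) ≠ 0)
      have hd2 := hν.differentiableAt (by simp : (∞ : WithTop ℕ∞) ≠ 0)
      have h1 : fderiv ℝ (fun x => (f x, (ν x : E3))) (u, 0) (0, 1) = 0 := by
        rw [hd1.fderiv_prodMk hd2]
        refine Prod.ext ?_ ?_
        · exact (pv_eq hd1).symm.trans hnull0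
        · exact (pv_eq hd2).symm.trans h0
      have h2 := h.immersive _ hu (h1.trans (map_zero _).symm)
      simp at h2
    have hVT : ⟪V, pu f (u, 0)⟫ = 0 := by
      rw [real_inner_comm, hV, h.inner_pu_pv_gauss hD hu, pv_pu_eq_pu_pv hf]
      have h1 : pu (pv f) (u, 0) = 0 := by
        have h2 : (fun s => pv f (s, 0)) =ᶠ[𝓝 u] fun _ => 0 := hnull
        exact h2.deriv_eq.trans (deriv_const _ _)
      rw [h1, inner_zero_left, neg_zero]
    have hVeq := eq_smul_cross (h.inner_pv_gauss hD hu) hVT (h.inner_pu hD hu) hn hTne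
    set m := ⟪V, cross (ν (u, 0) : E3) (pu f (u, 0))⟫ / ‖pu f (u, 0)‖ ^ 2
    have hm : m ≠ 0 := fun h0 => hVne (hVeq.trans (by rw [h0, zero_smul]))
    have h1 : m * det3 (pu (fun x => (ν x : E3)) (u, 0))
        (cross (ν (u, 0) : E3) (pu f (u, 0))) (ν (u, 0)) = 0 := by
      have h2 : det3 (pu (fun x => (ν x : E3)) (u, 0)) V (ν (u, 0)) = 0 := hdisc
      have h3 : V = m • cross (ν (u, 0) : E3) (pu f (u, 0)) := hVeq
      refine Eq.trans ?_ h2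
      rw [h3]
      simp only [det3_eq, PiLp.smul_apply, smul_eq_mul]
      ring
    have h4 := (mul_eq_zero.1 h1).resolve_left hm
    rw [det3_cross_self, hn, h.inner_pu_gauss hD hu] at h4
    have h5 : ⟪pu (fun x => (ν x : E3)) (u, 0), pu f (u, 0)⟫ = 0 := by linarith
    exact h5

/-- On the singular axis `∂_v λ = det(f_u, f_vv, ν)`. -/
lemma IsFront.pv_signedAreaDensity (h : IsFront f ν D) (hD : IsOpen D) (hq : q ∈ D)
    (hnull : pv f q = 0) :
    pv (signedAreaDensity f ν) q = det3 (pu f q) (pv (pv f) q) (ν q) := by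
  have hf := h.contDiffAt hD hq
  have hν := h.contDiffAt_gauss hD hq
  have h1 := (hasDerivAt_pv ((contDiffAt_pv hf).differentiableAt (by simp)))
  have h2 := (hasDerivAt_pv ((contDiffAt_cross hν (contDiffAt_pu hf)).differentiableAt (by simp)))
  have h3 := (h1.inner ℝ h2).deriv
  rw [← pv_eq ((contDiffAt_pv hf).differentiableAt (by simp)), hnull, inner_zero_left, zero_add,
    ← det3_eq_inner_cross'] at h3
  rw [← h3]
  simp only [← det3_eq_inner_cross']
  rfl

end Front

/-! ### The singular locus of a cusp of the Gauss map -/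

/-- A regular curve of singular points through a cusp `p` of `ν` is mapped by `ν` to an ordinary
cusp: in the normal form `(u, v³ + uv)` it is `v ↦ (-3v², v)`, with image `v ↦ (-3v², -2v³)`. -/
lemma IsCuspOfMap.isOrdinaryCusp_comp {ν : ℝ × ℝ → S2} {p : ℝ × ℝ} (h : IsCuspOfMap ν p)
    {γ : ℝ → ℝ × ℝ} (hγ : ∀ᶠ t in 𝓝 (0 : ℝ), ContDiffAt ℝ ∞ γ t) (hγ0 : γ 0 = p)
    (hγ' : deriv γ 0 ≠ 0)
    (hsing : ∀ᶠ t in 𝓝 (0 : ℝ), DifferentiableAt ℝ (fun x => (ν x : E3)) (γ t) ∧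
      ∃ Y : ℝ × ℝ, Y ≠ 0 ∧ fderiv ℝ (fun x => (ν x : E3)) (γ t) Y = 0) :
    IsOrdinaryCusp (fun t => ν (γ t)) 0 := by
  obtain ⟨φ, Φ, I, hp, hp0, hev⟩ := AEquivalentAt.exists_immersion_sphere h
  have hγc := hγ.self_of_nhds
  have hγt : Tendsto γ (𝓝 0) (𝓝 p) := hγ0 ▸ hγc.continuousAt
  set ψ : ℝ → ℝ := fun t => (φ (γ t)).2 with hψ
  have hfst : ∀ᶠ t in 𝓝 (0 : ℝ), (φ (γ t)).1 = -3 * ψ t ^ 2 := by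
    filter_upwards [hγt.eventually hev.eventually_nhds, hsing] with t ht ⟨hd, Y, hY, hY0⟩
    have h1 := ht.self_of_nhds
    exact fst_eq_of_singular_of_cusp_normal_form h1.1 (ht.mono fun x hx => hx.2.1) h1.2.2.1
      h1.2.2.2.1 hd hY hY0
  have hφγ : ∀ᶠ t in 𝓝 (0 : ℝ), ContDiffAt ℝ ∞ (fun t => φ (γ t)) t := by
    filter_upwards [hγt.eventually hev, hγ] with t ht hgt
    exact (partialDiffeo_contDiffAt φ ht.1).comp t hgt
  have hψc : ∀ᶠ t in 𝓝 (0 : ℝ), ContDiffAt ℝ ∞ ψ t := hφγ.mono fun t ht => ht.snd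
  have hψ0 : ψ 0 = 0 := by simp only [hψ, hγ0, hp0, Prod.snd_zero]
  have hψ' : deriv ψ 0 ≠ 0 := by
    intro h0
    have hd1 := (hγc.differentiableAt (by simp : (∞ : WithTop ℕ∞) ≠ 0)).hasDerivAt
    have hφd : HasFDerivAt φ (fderiv ℝ φ p) (γ 0) := by
      rw [hγ0]
      exact ((partialDiffeo_contDiffAt φ hp).differentiableAt (by simp)).hasFDerivAt
    have hd : HasDerivAt (fun t => φ (γ t)) (fderiv ℝ φ p (deriv γ 0)) 0 :=
      hφd.comp_hasDerivAt 0 hd1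
    have h2 : (fderiv ℝ φ p (deriv γ 0)).2 = 0 := (hasDerivAt_snd hd).deriv.symm.trans h0
    have h1 : (fderiv ℝ φ p (deriv γ 0)).1 = 0 := by
      have e1 : HasDerivAt (fun t => (φ (γ t)).1) (-3 * (2 * ψ 0 ^ 1 * deriv ψ 0)) 0 :=
        (((hψc.self_of_nhds.differentiableAt (by simp)).hasDerivAt.pow 2).const_mul
          (-3)).congr_of_eventuallyEq hfst
      rw [(hasDerivAt_fst hd).unique e1, hψ0]
      ring
    exact hγ' (fderiv_partialDiffeo_injective φ hp
      ((Prod.ext h1 h2 : _ = (0 : ℝ × ℝ)).trans (map_zero _).symm))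
  refine IsOrdinaryCusp.of_partialDiffeo Φ hψc hψ0 hψ' ?_
  filter_upwards [hγt.eventually hev, hfst] with t ht h1
  refine ⟨ht.2.2.2.2.1, ht.2.2.2.2.2.trans ?_⟩
  rw [h1]
  ext i
  fin_cases i
  · rfl
  · change ψ t ^ 3 + -3 * ψ t ^ 2 * ψ t = -2 * ψ t ^ 3
    ring

/-! ### Orientation of the singular curve -/

lemma nonneg_of_hasDerivAt_of_pos_right {l : ℝ → ℝ} {d : ℝ} (h : HasDerivAt l d 0) (h0 : l 0 = 0)
    (hpos : ∀ᶠ s in 𝓝[>] (0 : ℝ), 0 < l s) : 0 ≤ d := by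
  have h1 := h.tendsto_slope_zero_right
  refine ge_of_tendsto h1 ?_
  filter_upwards [hpos, self_mem_nhdsWithin] with s hs hs0
  have hs0' : (0 : ℝ) < s := hs0
  simp only [zero_add, h0, sub_zero, smul_eq_mul]
  positivity

/-- Let `X` be orientation preserving with `X 0 = p`, let `l` vanish on the image of the `u`-axis
near `p`, and let `w`, the image of `(a, 0)` under the differential of `X` at `0`, be tangent to it.
If `l > 0` on the left normal of `w`, then `∂_v m` and `a` do not have opposite signs, where `m` is
`l` in the coordinates `X`, multiplied by the Jacobian of `X`. -/
lemma mul_nonneg_of_pos_left {X : PartialDiffeomorph 𝓘(ℝ, ℝ × ℝ) 𝓘(ℝ, ℝ × ℝ) (ℝ × ℝ) (ℝ × ℝ) ∞}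
    {p w : ℝ × ℝ} (hX : (0 : ℝ × ℝ) ∈ X.source) (hX0 : X 0 = p)
    (hdet : ∀ q ∈ X.source, 0 < (fderiv ℝ X q).det) {l m : ℝ × ℝ → ℝ}
    (hm : ContDiffAt ℝ ∞ m 0) (hml : ∀ q ∈ X.source, m q = (fderiv ℝ X q).det * l (X q))
    (hm0 : ∀ᶠ u in 𝓝 (0 : ℝ), m (u, 0) = 0) {a : ℝ} (ha : a ≠ 0) (hw : fderiv ℝ X 0 (a, 0) = w)
    (hl : ∀ᶠ s in 𝓝[>] (0 : ℝ), 0 < l (p + s • (-w.2, w.1))) :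
    0 ≤ pv m (0, 0) * a := by
  have hpt : p ∈ X.target := hX0 ▸ partialDiffeo_map_mem X hX
  have hsp : X.symm p = 0 := by rw [← hX0]; exact partialDiffeo_left_inv X hX
  set J : ℝ × ℝ := (-w.2, w.1) with hJ
  set z := fderiv ℝ X.symm p J with hz
  have hLz : fderiv ℝ X 0 z = J := by
    rw [hz, ← hX0]
    exact fderiv_apply_fderiv_symm X hX J
  have hexp : ∀ x y : ℝ, fderiv ℝ X 0 (x, y) =
      x • fderiv ℝ X 0 (1, 0) + y • fderiv ℝ X 0 (0, 1) := by
    intro x y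
    rw [← map_smul, ← map_smul, ← map_add]
    simp
  -- `(a, 0)` and `z` form a positive basis, as their images `w` and `J` do
  have hpos : 0 < a * z.2 := by
    have hd := hdet 0 hX
    have h1 : (fderiv ℝ X 0).det * (a * z.2) = w.1 * w.1 + w.2 * w.2 := by
      have e1 := hexp a 0
      have e2 := hexp z.1 z.2
      rw [hw] at e1
      rw [Prod.mk.eta, hLz] at e2
      have e11 := congrArg Prod.fst e1
      have e12 := congrArg Prod.snd e1
      have e21 := congrArg Prod.fst e2
      have e22 := congrArg Prod.snd e2
      simp only [Prod.fst_add, Prod.snd_add, Prod.smul_fst, Prod.smul_snd, smul_eq_mul, hJ]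
        at e11 e12 e21 e22
      rw [det_eq_entries]
      set P := fderiv ℝ X 0 (1, 0)
      set Q := fderiv ℝ X 0 (0, 1)
      linear_combination (-w.1) * e22 + w.2 * e21 - (z.1 * P.2 + z.2 * Q.2) * e11
        + (z.1 * P.1 + z.2 * Q.1) * e12
    have hw0 : w ≠ 0 := by
      rintro rfl
      have := fderiv_partialDiffeo_injective X hX (hw.trans (map_zero _).symm)
      simp [ha] at this
    have h2 : 0 < w.1 * w.1 + w.2 * w.2 := by
      rcases not_and_or.1 (fun h : w.1 = 0 ∧ w.2 = 0 => hw0 (Prod.ext h.1 h.2)) with h | h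
      · have := mul_self_pos.2 h
        nlinarith [mul_self_nonneg w.2]
      · have := mul_self_pos.2 h
        nlinarith [mul_self_nonneg w.1]
    exact pos_of_mul_pos_right (h1 ▸ h2) hd.le
  have hmd := hm.differentiableAt (by simp : (∞ : WithTop ℕ∞) ≠ 0)
  have hpu : pu m (0, 0) = 0 := by
    have h1 : (fun s : ℝ => m (s, 0)) =ᶠ[𝓝 0] fun _ => 0 := hm0
    exact h1.deriv_eq.trans (deriv_const _ _)
  have hsd := hasDerivAt_line ((partialDiffeo_symm_contDiffAt X hpt).differentiableAt (by simp)) J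
  have hld : HasDerivAt (fun s : ℝ => m (X.symm (p + s • J))) (fderiv ℝ m 0 z) 0 := by
    refine HasFDerivAt.comp_hasDerivAt (l := m) (f := fun s : ℝ => X.symm (p + s • J)) 0 ?_ hsd
    have : X.symm (p + (0 : ℝ) • J) = 0 := by rw [zero_smul, add_zero, hsp]
    rw [this]
    exact hmd.hasFDerivAt
  have hfz : fderiv ℝ m 0 z = z.2 * pv m (0, 0) := by
    have h1 := fderiv_eq_partials (q := ((0 : ℝ), (0 : ℝ))) hmd z.1 z.2
    rw [hpu, smul_zero, zero_add, smul_eq_mul] at h1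
    exact h1
  have hnn : 0 ≤ z.2 * pv m (0, 0) := by
    rw [← hfz]
    refine nonneg_of_hasDerivAt_of_pos_right hld ?_ ?_
    · rw [zero_smul, add_zero, hsp]
      exact hm0.self_of_nhds
    · have hev : ∀ᶠ s in 𝓝[>] (0 : ℝ), p + s • J ∈ X.target :=
        ((tendsto_line p J).mono_left nhdsWithin_le_nhds).eventually (X.open_target.mem_nhds hpt)
      filter_upwards [hl, hev] with s hs1 hs2
      have hmem := partialDiffeo_symm_mem X hs2
      rw [hml _ hmem, partialDiffeo_right_inv X hs2]
      exact mul_pos (hdet _ hmem) hs1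
  by_contra hneg
  push Not at hneg
  nlinarith [mul_nonneg hnn hpos.le, mul_pos hpos hpos, mul_self_pos.2 ha]

lemma sign_eq_of_mul_pos {x y : ℝ} (h : 0 < x * y) : SignType.sign x = SignType.sign y := by
  rcases pos_and_pos_or_neg_and_neg_of_mul_pos h with ⟨hx, hy⟩ | ⟨hx, hy⟩
  · rw [sign_pos hx, sign_pos hy]
  · rw [sign_neg hx, sign_neg hy]

/-! ### The front along the singular axis of adapted coordinates -/

/-- In adapted coordinates at a cuspidal edge, where the singular points are parabolic points, the
restriction of the front to the singular axis satisfies the conditions of `IsSingularAxisFrame`. -/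
lemma IsAdapted.eventually_isSingularAxisFrame
    {X : PartialDiffeomorph 𝓘(ℝ, ℝ × ℝ) 𝓘(ℝ, ℝ × ℝ) (ℝ × ℝ) (ℝ × ℝ) ∞} {f : ℝ × ℝ → E3}
    {ν : ℝ × ℝ → S2} {D U : Set (ℝ × ℝ)} {p : ℝ × ℝ} (hX : IsAdapted X f D p) (hD : IsOpen D)
    (hf : IsFront f ν D) (hp : IsCuspidalEdge f p) (hU : IsOpen U) (hpU : p ∈ U)
    (hdisc : ∀ q ∈ U, q ∈ singularSet f D → discriminant ν q = 0) :
    ∀ᶠ u in 𝓝 (0 : ℝ), IsSingularAxisFrame (fun s => (ν (X (s, 0)) : E3))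
      (fun s => pu (fun q => f (X q)) (s, 0)) (fun s => pv (pv fun q => f (X q)) (s, 0)) u := by
  have hXp := hX.map_zero
  have h0s := hX.zero_mem
  have hXc := partialDiffeo_contDiffAt X h0s
  have hXt : Tendsto X (𝓝 0) (𝓝 p) := hXp ▸ hXc.continuousAt
  set g : ℝ × ℝ → E3 := fun q => f (X q) with hg
  set n : ℝ × ℝ → S2 := fun q => ν (X q) with hn
  have hgn : IsFront g n X.source := hf.comp hD X hX.subset
  have hXo := X.open_source
  have hXD : ∀ q ∈ X.source, X q ∈ D := fun q hq => hX.subset (partialDiffeo_map_mem X hq)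
  have hXd : ∀ q ∈ X.source, DifferentiableAt ℝ X q := fun q hq =>
    (partialDiffeo_contDiffAt X hq).differentiableAt (by simp)
  have haxis : Tendsto (fun u : ℝ => (u, (0 : ℝ))) (𝓝 0) (𝓝 0) := tendsto_mk_left 0
  have haxis_mem : ∀ᶠ u in 𝓝 (0 : ℝ), (u, (0 : ℝ)) ∈ X.source ∧ X (u, 0) ∈ U :=
    haxis.eventually ((hXo.eventually_mem h0s).and (hXt.eventually (hU.mem_nhds hpU)))
  have hnull : ∀ᶠ u in 𝓝 (0 : ℝ), pv g (u, 0) = 0 := haxis_mem.mono fun u hu => hX.null u hu.1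
  have hcross0 : cross (pu g (0, 0)) (pv (pv g) (0, 0)) ≠ 0 :=
    hp.cross_ne_zero h0s hXp hnull.self_of_nhds
  have hc : ContinuousAt (fun q => cross (pu g q) (pv (pv g) q)) 0 :=
    (contDiffAt_cross (contDiffAt_pu (hgn.contDiffAt hXo h0s))
      (contDiffAt_pv (contDiffAt_pv (hgn.contDiffAt hXo h0s)))).continuousAt
  filter_upwards [haxis_mem, hnull.eventually_nhds,
    haxis.eventually (hc.eventually_ne hcross0)] with u hu1 hu2 hu3
  refine hgn.isSingularAxisFrame hXo hu1.1 hu2 ?_ hu3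
  have h1 : discriminant ν (X (u, 0)) = 0 :=
    hdisc _ hu1.2 ((hX.singular_iff _ hu1.1).2 rfl)
  have h2 := det3_partials_comp (k := fun x => (ν x : E3)) (hXd _ hu1.1)
    ((hf.contDiffAt_gauss hD (hXD _ hu1.1)).differentiableAt (by simp)) (ν (X (u, 0)))
  refine h2.trans (mul_eq_zero_of_right _ h1)

/-- In adapted coordinates the singular curve runs along the axis. -/
lemma IsAdapted.exists_axis_parametrization
    {X : PartialDiffeomorph 𝓘(ℝ, ℝ × ℝ) 𝓘(ℝ, ℝ × ℝ) (ℝ × ℝ) (ℝ × ℝ) ∞} {f : ℝ × ℝ → E3}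
    {D : Set (ℝ × ℝ)} {p : ℝ × ℝ} (hX : IsAdapted X f D p) {γ : ℝ → ℝ × ℝ}
    (hγ0c : ContDiffAt ℝ ∞ γ 0) (hγ0 : γ 0 = p) (hγ' : deriv γ 0 ≠ 0)
    (hsing : ∀ᶠ t in 𝓝 (0 : ℝ), γ t ∈ singularSet f D) :
    ∃ a : ℝ → ℝ, ContDiffAt ℝ ∞ a 0 ∧ a 0 = 0 ∧ deriv a 0 ≠ 0 ∧
      fderiv ℝ X 0 (deriv a 0, 0) = deriv γ 0 ∧ ∀ᶠ t in 𝓝 (0 : ℝ), γ t = X (a t, 0) := by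
  have hXp := hX.map_zero
  have h0s := hX.zero_mem
  have hpt : p ∈ X.target := hXp ▸ partialDiffeo_map_mem X h0s
  have hXd0 : DifferentiableAt ℝ X 0 :=
    (partialDiffeo_contDiffAt X h0s).differentiableAt (by simp)
  set a : ℝ → ℝ := fun t => (X.symm (γ t)).1 with ha
  have hγt : Tendsto γ (𝓝 0) (𝓝 p) := hγ0 ▸ hγ0c.continuousAt
  have hsp : X.symm p = 0 := by rw [← hXp]; exact partialDiffeo_left_inv X h0s
  have hyc : ContDiffAt ℝ ∞ (fun t => X.symm (γ t)) 0 := by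
    have h1 := partialDiffeo_symm_contDiffAt X hpt
    rw [← hγ0] at h1
    exact h1.comp 0 hγ0c
  have hac : ContDiffAt ℝ ∞ a 0 := hyc.fst
  have ha0 : a 0 = 0 := by simp only [ha, hγ0, hsp, Prod.fst_zero]
  have hγa : ∀ᶠ t in 𝓝 (0 : ℝ), γ t = X (a t, 0) := by
    filter_upwards [hγt.eventually (X.open_target.mem_nhds hpt), hsing] with t ht1 ht2
    have h1 := partialDiffeo_right_inv X ht1
    have h2 : (X.symm (γ t)).2 = 0 :=
      (hX.singular_iff _ (partialDiffeo_symm_mem X ht1)).1 (by rw [h1]; exact ht2)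
    have h3 : X.symm (γ t) = (a t, 0) := Prod.ext rfl h2
    rw [← h3, h1]
  have hXa : fderiv ℝ X 0 (deriv a 0, 0) = deriv γ 0 := by
    have h1 : HasDerivAt (fun t => (a t, (0 : ℝ))) (deriv a 0, 0) 0 :=
      (hac.differentiableAt (by simp)).hasDerivAt.prodMk (hasDerivAt_const 0 0)
    have h2 : HasFDerivAt X (fderiv ℝ X 0) (a 0, 0) := by
      rw [ha0]
      exact hXd0.hasFDerivAt
    have h3 : HasDerivAt (fun t => X (a t, 0)) (fderiv ℝ X 0 (deriv a 0, 0)) 0 :=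
      h2.comp_hasDerivAt (f := fun t => (a t, (0 : ℝ))) 0 h1
    have h4 : γ =ᶠ[𝓝 0] fun t => X (a t, 0) := hγa
    rw [h4.deriv_eq, h3.deriv]
  have ha' : deriv a 0 ≠ 0 := by
    intro h0
    refine hγ' ?_
    rw [← hXa, h0]
    exact _root_.map_zero _
  exact ⟨a, hac, ha0, ha', hXa, hγa⟩

/-- The sign in the definition of the singular curvature is the orientation, with respect to the
axis of the adapted coordinates, of the singular curve `γ` which has the region `λ > 0` on its left,
`(a, 0)` being the velocity of `γ` in these coordinates. -/
lemma IsAdapted.sign_pv_signedAreaDensity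
    {X : PartialDiffeomorph 𝓘(ℝ, ℝ × ℝ) 𝓘(ℝ, ℝ × ℝ) (ℝ × ℝ) (ℝ × ℝ) ∞} {f : ℝ × ℝ → E3}
    {ν : ℝ × ℝ → S2} {D : Set (ℝ × ℝ)} {p w : ℝ × ℝ} (hX : IsAdapted X f D p) (hD : IsOpen D)
    (hf : IsFront f ν D) (hp : IsCuspidalEdge f p) {a : ℝ} (ha' : a ≠ 0)
    (hXa : fderiv ℝ X 0 (a, 0) = w)
    (hleft : ∀ᶠ s in 𝓝[>] (0 : ℝ), 0 < signedAreaDensity f ν (p + s • (-w.2, w.1))) :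
    SignType.sign (pv (signedAreaDensity (fun q => f (X q)) fun q => ν (X q)) (0, 0)) =
      SignType.sign a := by
  have hXp := hX.map_zero
  have h0s := hX.zero_mem
  set g : ℝ × ℝ → E3 := fun q => f (X q) with hg
  set n : ℝ × ℝ → S2 := fun q => ν (X q) with hn
  have hgn : IsFront g n X.source := hf.comp hD X hX.subset
  have hXo := X.open_source
  have hXD : ∀ q ∈ X.source, X q ∈ D := fun q hq => hX.subset (partialDiffeo_map_mem X hq)
  have hXd : ∀ q ∈ X.source, DifferentiableAt ℝ X q := fun q hq =>
    (partialDiffeo_contDiffAt X hq).differentiableAt (by simp)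
  have haxis : Tendsto (fun u : ℝ => (u, (0 : ℝ))) (𝓝 0) (𝓝 0) := tendsto_mk_left 0
  have hnull : ∀ᶠ u in 𝓝 (0 : ℝ), pv g (u, 0) = 0 :=
    (haxis.eventually (hXo.eventually_mem h0s)).mono fun u hu => hX.null u hu
  refine sign_eq_of_mul_pos (lt_of_le_of_ne ?_ ?_)
  · refine mul_nonneg_of_pos_left h0s hXp hX.orientation (l := signedAreaDensity f ν)
      (hgn.contDiffAt_signedAreaDensity hXo h0s) (fun q hq => ?_) ?_ ha' hXa hleft
    · exact det3_partials_comp (hXd q hq)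
        ((hf.contDiffAt hD (hXD q hq)).differentiableAt (by simp)) _
    · filter_upwards [hnull] with u hu
      simp [signedAreaDensity, hu, det3_eq]
  · have h1 := hgn.pv_signedAreaDensity hXo h0s hnull.self_of_nhds
    have h2 := cross_eq_smul (hgn.inner_pu hXo h0s) (b := pv (pv g) 0) ?_ (norm_coe_S2 _)
    · refine (mul_ne_zero ?_ ha').symm
      intro h3
      refine hp.cross_ne_zero h0s hXp hnull.self_of_nhds (h2.trans ?_)
      rw [← h1, show pv (signedAreaDensity g n) 0 = 0 from h3, zero_smul]
    · exact hgn.inner_pv_pv hXo h0s hnull.self_of_nhds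

/-- The cuspidal curvature of the image of a singular axis under the Gauss map: the curve is
`N ∘ a`, where `a` is a reparametrization of the axis. -/
lemma IsOrdinaryCusp.cuspidalCurvature_eq_of_axis {c : ℝ → S2} (hcusp : IsOrdinaryCusp c 0)
    {N T H : ℝ → E3} (hframe : ∀ᶠ u in 𝓝 (0 : ℝ), IsSingularAxisFrame N T H u) {a : ℝ → ℝ}
    (hac : ContDiffAt ℝ ∞ a 0) (ha0 : a 0 = 0) (ha' : deriv a 0 ≠ 0)
    (hcN : (fun t => (c t : E3)) =ᶠ[𝓝 0] fun t => N (a t)) :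
    deriv (rotationRate N T) 0 ≠ 0 ∧
    cuspidalCurvature c 0 = 2 * ((SignType.sign (deriv a 0) : ℝ) *
      (det3 (T 0) (deriv T 0) (N 0) / ‖T 0‖ ^ 3)) / √(|deriv (rotationRate N T) 0| / ‖T 0‖) := by
  have hfr0 := hframe.self_of_nhds
  set r := rotationRate N T with hr
  obtain ⟨hc1, hc2⟩ := hcusp.deriv_eq_zero_and
  have hNa : ContDiffAt ℝ ∞ N (a 0) := by rw [ha0]; exact hfr0.smooth_N
  have hcc : ContDiffAt ℝ ∞ (fun t => (c t : E3)) 0 :=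
    (hNa.comp 0 hac).congr_of_eventuallyEq hcN
  have hr0 : r 0 = 0 := by
    have h1 : deriv (fun t => N (a t)) 0 = deriv a 0 • deriv N (a 0) :=
      (HasDerivAt.scomp 0 (hNa.differentiableAt (by simp)).hasDerivAt
        (hac.differentiableAt (by simp)).hasDerivAt).deriv
    rw [← hcN.deriv_eq, hc1, ha0] at h1
    have h2 : deriv N 0 = 0 := (smul_eq_zero.1 h1.symm).resolve_left ha'
    rw [hr, rotationRate, h2, inner_zero_left, zero_div]
  obtain ⟨hd2, hd3⟩ := derivs_comp_axis hac ha0 hframe hr0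
  have hr' : deriv r 0 ≠ 0 := by
    intro h0
    refine hc2 ?_
    rw [hcN.deriv.deriv_eq, hd2, ← hr, h0, mul_zero, zero_smul]
  have hTpos : 0 < ‖T 0‖ := norm_pos_iff.2 hfr0.T_ne
  have hnorm : ‖cross (N 0) (T 0)‖ = ‖T 0‖ := by
    have h1 := norm_cross_sq (N 0) (T 0)
    rw [hfr0.unit, real_inner_comm, hfr0.T_orth] at h1
    exact (sq_eq_sq₀ (norm_nonneg _) (norm_nonneg _)).1 (by linarith)
  refine ⟨hr', ?_⟩
  have hN0 : (c 0 : E3) = N 0 := hcN.self_of_nhds.trans (congrArg N ha0)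
  rw [cuspidalCurvature_of_deriv_eq_zero hcc hc1, hcN.deriv.deriv.deriv_eq, hcN.deriv.deriv_eq,
    hN0, hd3, hd2, norm_smul, hnorm, Real.norm_eq_abs, abs_mul,
    abs_of_nonneg (sq_nonneg (deriv a 0))]
  exact cuspidal_quotient_identity ha' hr' hTpos

lemma cuspidalTorsionDeriv_eq {g : ℝ × ℝ → E3} {N : ℝ → E3}
    (h : ∀ᶠ u in 𝓝 (0 : ℝ),
      IsSingularAxisFrame N (fun s => pu g (s, 0)) (fun s => pv (pv g) (s, 0)) u) :
    cuspidalTorsionDeriv g =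
      -(deriv (rotationRate N fun s => pu g (s, 0)) 0 / ‖pu g (0, 0)‖) := by
  have h1 : cuspidalTorsion g =ᶠ[𝓝 0] fun u => - rotationRate N (fun s => pu g (s, 0)) u :=
    h.eventually_nhds.mono fun u hu => cuspidalTorsion_eq_neg_rotationRate
      (T := fun s => pu g (s, 0)) (H := fun s => pv (pv g) (s, 0)) hu
  rw [cuspidalTorsionDeriv, h1.deriv_eq, deriv.fun_neg, neg_div]

end FrontSurface

theorem theoremB
    (D : Set (ℝ × ℝ)) (hD : IsOpen D)
    (f : ℝ × ℝ → E3) (ν : ℝ × ℝ → S2) (hf : IsFront f ν D)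
    (p : ℝ × ℝ) (hp : IsCuspidalEdge f p)
    (U : Set (ℝ × ℝ)) (hU : IsOpen U) (hUD : U ⊆ D) (hpU : p ∈ U)
    (ε : ℝ) (hε : 0 < ε) (γ : ℝ → ℝ × ℝ) (hγ : IsSingularCurve γ ε f D U p)
    -- the left-hand side of the singular curve is the region where the density is positive
    (hleft : PositiveOnLeft γ ε (signedAreaDensity f ν))
    -- the Gaussian curvature is non-zero and bounded
    (hK : ∀ q ∈ U, q ∉ singularSet f D → gaussianCurvature f ν q ≠ 0)
    (hKb : ∃ C : ℝ, ∀ q ∈ U, q ∉ singularSet f D → |gaussianCurvature f ν q| ≤ C)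
    (hν : IsCuspOfMap ν p) :
    -- near `p`, the singular curve is a parabolic curve
    (∃ δ ∈ Ioc 0 ε, ∃ V ⊆ U, IsOpen V ∧ p ∈ V ∧ IsParabolicCurve γ δ ν V p) ∧
    IsOrdinaryCusp (fun t => ν (γ t)) 0 ∧
    -- adapted coordinates exist, and the rest holds in all of them
    (∃ X, IsAdapted X f D p) ∧
    ∀ X, IsAdapted X f D p →
      (IsPositiveCusp (fun t => ν (γ t)) 0 ↔
        0 < singularCurvature (fun q => f (X q)) (fun q => ν (X q)) 0) ∧
      (IsNegativeCusp (fun t => ν (γ t)) 0 ↔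
        singularCurvature (fun q => f (X q)) (fun q => ν (X q)) 0 < 0) ∧
      cuspidalTorsionDeriv (fun q => f (X q)) ≠ 0 ∧
      cuspidalCurvature (fun t => ν (γ t)) 0 =
        2 * singularCurvature (fun q => f (X q)) (fun q => ν (X q)) 0 /
          √|cuspidalTorsionDeriv (fun q => f (X q))| := by
  have hdisc : ∀ q ∈ U, discriminant ν q = 0 ↔ q ∈ singularSet f D := fun q hq =>
    hf.discriminant_eq_zero_iff hD hU hUD hγ hleft hK hKb hq
  have h0ε : (0 : ℝ) ∈ Ioo (-ε) ε := ⟨by linarith, hε⟩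
  have hγsing : ∀ t ∈ Ioo (-ε) ε, γ t ∈ singularSet f D ∩ U := fun t ht =>
    hγ.image_eq ▸ mem_image_of_mem γ ht
  have hnear : ∀ᶠ t in 𝓝 (0 : ℝ), t ∈ Ioo (-ε) ε := isOpen_Ioo.mem_nhds h0ε
  have hγc : ∀ t ∈ Ioo (-ε) ε, ContDiffAt ℝ ∞ γ t := fun t ht =>
    hγ.smooth.contDiffAt (isOpen_Ioo.mem_nhds ht)
  have hcusp : IsOrdinaryCusp (fun t => ν (γ t)) 0 := by
    refine hν.isOrdinaryCusp_comp (hnear.mono hγc) hγ.zero (hγ.regular 0 h0ε) ?_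
    filter_upwards [hnear] with t ht
    have h1 := hγsing t ht
    exact ⟨(hf.contDiffAt_gauss hD (hUD h1.2)).differentiableAt (by simp),
      hf.exists_fderiv_gauss_eq_zero hD (hUD h1.2) ((hdisc _ h1.2).2 h1.1)⟩
  refine ⟨⟨ε, ⟨hε, le_rfl⟩, U, Subset.rfl, hU, hpU, hγ.toIsRegularCurveThrough, ?_⟩, hcusp,
    hp.exists_isAdapted hD (hUD hpU) hf.smooth, ?_⟩
  · rw [hγ.image_eq]
    ext q
    exact ⟨fun h => ⟨h.2, (hdisc q h.2).2 h.1⟩, fun h => ⟨(hdisc q h.1).1 h.2, h.1⟩⟩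
  intro X hX
  suffices hmain : cuspidalTorsionDeriv (fun q => f (X q)) ≠ 0 ∧
      cuspidalCurvature (fun t => ν (γ t)) 0 =
        2 * singularCurvature (fun q => f (X q)) (fun q => ν (X q)) 0 /
          √|cuspidalTorsionDeriv (fun q => f (X q))| by
    obtain ⟨h1, h2⟩ := hmain
    have hs : 0 < √|cuspidalTorsionDeriv (fun q => f (X q))| :=
      Real.sqrt_pos.2 (abs_pos.2 h1)
    refine ⟨?_, ?_, h1, h2⟩
    · rw [IsPositiveCusp, and_iff_right hcusp, h2, div_pos_iff_of_pos_right hs]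
      exact mul_pos_iff_of_pos_left two_pos
    · rw [IsNegativeCusp, and_iff_right hcusp, h2, div_lt_iff₀ hs, zero_mul]
      constructor <;> intro h <;> linarith
  obtain ⟨a, hac, ha0, ha', hXa, hγa⟩ := hX.exists_axis_parametrization (hγc 0 h0ε) hγ.zero
    (hγ.regular 0 h0ε) (hnear.mono fun t ht => (hγsing t ht).1)
  have hframe := hX.eventually_isSingularAxisFrame hD hf hp hU hpU fun q hq => (hdisc q hq).2
  have hsign := hX.sign_pv_signedAreaDensity hD hf hp ha' hXa (by
    have h1 := hleft 0 h0ε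
    rwa [hγ.zero] at h1)
  obtain ⟨hr', hμ⟩ := hcusp.cuspidalCurvature_eq_of_axis hframe hac ha0 ha'
    (hγa.mono fun t ht => by simp only [ht])
  have hT := hframe.self_of_nhds.T_ne
  have htors := cuspidalTorsionDeriv_eq hframe
  refine ⟨?_, ?_⟩
  · rw [htors]
    exact neg_ne_zero.2 (div_ne_zero hr' (norm_ne_zero_iff.2 hT))
  · rw [hμ, htors, abs_neg, abs_div, abs_norm, ← hsign]
    rfl
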